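/- A partition of $n$ is identified with its Ferrers diagram, whose cells have coordinates (row, column); the empty partition is the only partition of $0$. For a partition $\lambda$ let $\mathrm{mex}_{2,1}(\lambda)$ (resp. $\mathrm{mex}_{2,2}(\lambda)$) be the smallest positive odd (resp. even) integer that is not a part of $\lambda$. A rim hook is an edgewise connected skew diagram containing no $2\times 2$ block of cells; its length is its number of cells, and its arm length is one less than the number of columns it occupies. If the main diagonal of $\mu$ consists of the $d$ cells $(i,i)$, $1\le i\le d$, let $x_i$ be the number of cells of row $i$ to the right of $(i,i)$ and $y_i$ the number of cells of column $i$ below $(i,i)$. For $a\in\{0,1\}$ and a partition $\lambda$ define $f^{(a)}(\lambda)$ as follows. (i) Let $D_a(\lambda)$ be the largest rectangle contained in $\lambda$ with upper-left cell $(1,1)$ whose horizontal side exceeds its vertical side by $a$; let $n_a$ be its vertical side ($n_a=0$ if there is no nonempty such rectangle), and let $A_a(\lambda)$ be the diagram formed by the cells of $\lambda$ in the first $n_a$ rows that are not in $D_a(\lambda)$ (moved $n_a+a$ columns to the left). (ii) As long as the current diagram, initially $A_a(\lambda)$, has at least $n_a+a+1$ columns, strip away from it the longest one among those rim hooks of arm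 length $n_a+a$ that have a cell in its last column and whose removal leaves a Ferrers diagram. Let $R_a(\lambda)$ be the diagram that remains at the end. (iii) With $x_1,\dots,x_d$ and $y_1,\dots,y_d$ taken for $R_a(\lambda)$, and $y_0=n_a$, $x_{d+1}=-1$, put $$f^{(a)}(\lambda)=\max_{0\le i\le d}(y_i-x_{i+1})-1 .$$ Set $\mathrm{sqrank}(\lambda)=f^{(0)}(\lambda)$ and $\mathrm{rerank}(\lambda)=f^{(1)}(\lambda)$. **Theorem.** For all integers $n,r\ge 0$: (1) the number of partitions $\lambda$ of $n$ with $\mathrm{mex}_{2,1}(\lambda)=2r+1$ equals the number of partitions $\lambda$ of $n$ with $\mathrm{sqrank}(\lambda)=r$; (2) the number of partitions $\lambda$ of $n$ with $\mathrm{mex}_{2,2}(\lambda)=2r+2$ equals the number of partitions $\lambda$ of $n$ with $\mathrm{rerank}(\lambda)=r$. -/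

import Mathlib

namespace OddEvenMex

/-! ### Minimal excludants and Ferrers diagrams -/

/-- `mex A a p` is the smallest positive integer congruent to `a` modulo `A` that is not a part
of the partition `p`. -/
noncomputable def mex (A a : ℕ) {n : ℕ} (p : n.Partition) : ℕ :=
  sInf {k : ℕ | 0 < k ∧ k ≡ a [MOD A] ∧ k ∉ p.parts}

/-- The Ferrers diagram of a partition: row `i` (counted from `0`) has as many cells as the
`i`-th largest part. -/
def ferrers {n : ℕ} (p : n.Partition) : YoungDiagram :=
  YoungDiagram.ofRowLens (p.parts.sort (· ≥ ·)) (p.parts.pairwise_sort (· ≥ ·)).sortedGE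

/-! ### Rim hooks

Cells are pairs (row, column), both counted from `0`, as in `YoungDiagram`. -/

/-- The cells of the skew diagram `μ / ν`. -/
def skewCells (μ ν : YoungDiagram) : Finset (ℕ × ℕ) := μ.cells \ ν.cells

/-- The skew diagram `μ / ν` is a rim hook: it is (nonempty and) edgewise connected and contains
no `2 × 2` block. Two cells are joined in the Hasse diagram of `ℕ × ℕ` iff they share an edge. -/
structure IsRimHook (μ ν : YoungDiagram) : Prop where
  le : ν ≤ μ
  connected : ((SimpleGraph.hasse (ℕ × ℕ)).induce (skewCells μ ν : Set (ℕ × ℕ))).Connected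
  no_block : ∀ i j : ℕ,
    ¬ ({(i, j), (i, j + 1), (i + 1, j), (i + 1, j + 1)} : Finset (ℕ × ℕ)) ⊆ skewCells μ ν

/-- The length of the rim hook `μ / ν`: its number of cells. -/
def hookLength (μ ν : YoungDiagram) : ℕ := (skewCells μ ν).card

/-- The number of columns occupied by `μ / ν`. -/
def numColumns (μ ν : YoungDiagram) : ℕ := ((skewCells μ ν).image Prod.snd).card

/-- The arm length of the rim hook `μ / ν`: one less than the number of columns it occupies. -/
def armLength (μ ν : YoungDiagram) : ℕ := numColumns μ ν - 1

/-- `μ / ν` is a rightmost rim hook of arm length `m`: it has a cell in the last column of `μ`. -/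
structure IsRightmostHook (m : ℕ) (μ ν : YoungDiagram) : Prop where
  isRimHook : IsRimHook μ ν
  armLength_eq : armLength μ ν = m
  rightmost : ∃ c ∈ skewCells μ ν, c.2 + 1 = μ.rowLen 0

/-- `ν` arises from `μ` by stripping away the longest of the rightmost rim hooks of arm
length `m`. -/
structure IsStrip (m : ℕ) (μ ν : YoungDiagram) : Prop where
  isRightmostHook : IsRightmostHook m μ ν
  longest : ∀ ν', IsRightmostHook m μ ν' → hookLength μ ν' ≤ hookLength μ ν

/-- The diagram left over from `μ` when all rim cells in the last `m + 1` columns are removed. -/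
def stripDiagram (m : ℕ) (μ : YoungDiagram) : YoungDiagram where
  cells := μ.cells.filter fun c => c.2 + (m + 1) < μ.rowLen 0 ∨ (c.1 + 1, c.2 + 1) ∈ μ
  isLowerSet := by
    rintro ⟨i, j⟩ ⟨i', j'⟩ ⟨hi, hj⟩ h
    simp only [Finset.coe_filter, Set.mem_ofPred_eq, YoungDiagram.mem_cells] at h ⊢
    simp only at hi hj
    refine ⟨μ.up_left_mem hi hj h.1, h.2.imp (fun h => by omega) fun h => ?_⟩
    exact μ.up_left_mem (by omega) (by omega) h

theorem mem_skew_strip {m : ℕ} {μ : YoungDiagram} {i j : ℕ} :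
    (i, j) ∈ skewCells μ (stripDiagram m μ) ↔
      (i, j) ∈ μ ∧ μ.rowLen 0 ≤ j + (m + 1) ∧ (i + 1, j + 1) ∉ μ := by
  simp only [skewCells, stripDiagram, Finset.mem_sdiff, Finset.mem_filter, YoungDiagram.mem_cells]
  grind

theorem adj_iff {a b : ℕ × ℕ} : (SimpleGraph.hasse (ℕ × ℕ)).Adj a b ↔
    (a.1 = b.1 ∧ (a.2 + 1 = b.2 ∨ b.2 + 1 = a.2)) ∨
    (a.2 = b.2 ∧ (a.1 + 1 = b.1 ∨ b.1 + 1 = a.1)) := by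
  simp only [SimpleGraph.hasse_adj, Prod.covBy_iff, Nat.covBy_iff_add_one_eq]
  omega

theorem isRightmostHook_strip {m : ℕ} {μ : YoungDiagram} (h : m < μ.rowLen 0) :
    IsRightmostHook m μ (stripDiagram m μ) := by
  have hlast : (0, μ.rowLen 0 - 1) ∈ skewCells μ (stripDiagram m μ) := by
    refine mem_skew_strip.2 ⟨YoungDiagram.mem_iff_lt_rowLen.2 (by omega), by omega, fun hc => ?_⟩
    have := YoungDiagram.mem_iff_lt_rowLen.1 (μ.up_left_mem (Nat.zero_le _) le_rfl hc)
    omega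
  have himage : (skewCells μ (stripDiagram m μ)).image Prod.snd =
      Finset.Ico (μ.rowLen 0 - (m + 1)) (μ.rowLen 0) := by
    ext j
    simp only [Finset.mem_image, Prod.exists, exists_eq_right, Finset.mem_Ico, mem_skew_strip]
    constructor
    · rintro ⟨i, h1, h2, -⟩
      have := YoungDiagram.mem_iff_lt_rowLen.1 (μ.up_left_mem (Nat.zero_le _) le_rfl h1)
      omega
    · rintro ⟨h1, h2⟩
      have h0 : (0, j) ∈ μ := YoungDiagram.mem_iff_lt_rowLen.2 h2
      have h0' := YoungDiagram.mem_iff_lt_colLen.1 h0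
      refine ⟨μ.colLen j - 1, YoungDiagram.mem_iff_lt_colLen.2 (by omega), by omega, fun hc => ?_⟩
      have := YoungDiagram.mem_iff_lt_colLen.1 (μ.up_left_mem le_rfl (Nat.le_succ j) hc)
      omega
  refine ⟨⟨?_, ?_, ?_⟩, ?_, ⟨_, hlast, by simp only; omega⟩⟩
  · rw [← YoungDiagram.cells_subset_iff]
    exact Finset.filter_subset _ _
  · rw [SimpleGraph.connected_iff_exists_forall_reachable]
    refine ⟨⟨(0, μ.rowLen 0 - 1), hlast⟩, ?_⟩
    suffices H : ∀ k i j, i + (μ.rowLen 0 - j) = k →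
        ∀ hc : (i, j) ∈ skewCells μ (stripDiagram m μ),
        ((SimpleGraph.hasse (ℕ × ℕ)).induce
          (skewCells μ (stripDiagram m μ) : Set (ℕ × ℕ))).Reachable
          ⟨(0, μ.rowLen 0 - 1), hlast⟩ ⟨(i, j), hc⟩ by
      rintro ⟨⟨i, j⟩, hc⟩
      exact H _ i j rfl hc
    intro k
    induction k using Nat.strong_induction_on with
    | _ k ih =>
      intro i j hk hc
      obtain ⟨h1, h2, h3⟩ := mem_skew_strip.1 hc
      have hj := YoungDiagram.mem_iff_lt_rowLen.1 (μ.up_left_mem (Nat.zero_le _) le_rfl h1)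
      by_cases hr : (i, j + 1) ∈ μ
      · have hc' : (i, j + 1) ∈ skewCells μ (stripDiagram m μ) :=
          mem_skew_strip.2 ⟨hr, by omega, fun hx => h3 (μ.up_left_mem le_rfl (by omega) hx)⟩
        refine (ih (i + (μ.rowLen 0 - (j + 1))) (by omega) i (j + 1) rfl hc').trans
          (SimpleGraph.Adj.reachable ?_)
        simp [SimpleGraph.comap_adj]
      · rcases i with _ | i
        · have : j = μ.rowLen 0 - 1 := by
            rw [YoungDiagram.mem_iff_lt_rowLen] at hr
            omega
          subst this
          exact SimpleGraph.Reachable.refl _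
        · have hc' : (i, j) ∈ skewCells μ (stripDiagram m μ) :=
            mem_skew_strip.2 ⟨μ.up_left_mem (by omega) le_rfl h1, h2, hr⟩
          refine (ih (i + (μ.rowLen 0 - j)) (by omega) i j rfl hc').trans
            (SimpleGraph.Adj.reachable ?_)
          simp [SimpleGraph.comap_adj]
  · intro i j hsub
    have h1 := mem_skew_strip.1 (hsub (show (i, j) ∈ _ by simp))
    have h2 := mem_skew_strip.1 (hsub (show (i + 1, j + 1) ∈ _ by simp))
    exact h1.2.2 h2.1
  · rw [armLength, numColumns, himage, Nat.card_Ico]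
    omega

theorem skewCells_subset {m : ℕ} {μ ν : YoungDiagram} (h : IsRightmostHook m μ ν) :
    skewCells μ ν ⊆ skewCells μ (stripDiagram m μ) := by
  rintro ⟨i, j⟩ hc
  have hμ : (i, j) ∈ μ := (Finset.mem_sdiff.1 hc).1
  have hν : (i, j) ∉ ν := (Finset.mem_sdiff.1 hc).2
  refine mem_skew_strip.2 ⟨hμ, ?_, fun hx => ?_⟩
  · by_contra! hj
    obtain ⟨e, he, he2⟩ := h.rightmost
    have key : Finset.Ico j (μ.rowLen 0) ⊆ (skewCells μ ν).image Prod.snd := by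
      intro k hk
      rw [Finset.mem_Ico] at hk
      by_contra hkn
      obtain ⟨w⟩ := h.isRimHook.connected.preconnected ⟨(i, j), hc⟩ ⟨e, he⟩
      have hne : ∀ x : (skewCells μ ν : Set (ℕ × ℕ)), x.1.2 ≠ k := fun x hx =>
        hkn (Finset.mem_image.2 ⟨x.1, x.2, hx⟩)
      have inv : ∀ (x y : (skewCells μ ν : Set (ℕ × ℕ))) (_ : ((SimpleGraph.hasse (ℕ × ℕ)).induce
          (skewCells μ ν : Set (ℕ × ℕ))).Walk x y), x.1.2 < k → y.1.2 < k := by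
        intro x y w
        induction w with
        | nil => exact id
        | @cons u v w hadj _ ih =>
          intro hu
          have := adj_iff.1 (show (SimpleGraph.hasse (ℕ × ℕ)).Adj u.1 v.1 from hadj)
          have := hne v
          exact ih (by omega)
      have h1 := hne ⟨(i, j), hc⟩
      have h2 := inv _ _ w (by simp only at h1 ⊢; omega)
      simp only at h2
      omega
    have hcard := Finset.card_le_card key
    rw [Nat.card_Ico] at hcard
    have := h.armLength_eq
    rw [armLength, numColumns] at this
    omega
  · apply h.isRimHook.no_block i j
    have out : ∀ a b, i ≤ a → j ≤ b → a ≤ i + 1 → b ≤ j + 1 → (a, b) ∈ skewCells μ ν :=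
      fun a b ha hb ha' hb' => Finset.mem_sdiff.2
        ⟨μ.up_left_mem ha' hb' hx, fun hn => hν (ν.up_left_mem ha hb hn)⟩
    intro x hx'
    simp only [Finset.mem_insert, Finset.mem_singleton] at hx'
    rcases hx' with rfl | rfl | rfl | rfl <;> apply out <;> omega

/-- If `μ` has more than `m` columns, then the longest rightmost rim hook of arm length `m` exists
and is unique. -/
theorem isStrip_iff {m : ℕ} {μ : YoungDiagram} (h : m < μ.rowLen 0) {ν : YoungDiagram} :
    IsStrip m μ ν ↔ ν = stripDiagram m μ := by
  constructor
  · intro hν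
    have h1 := Finset.eq_of_subset_of_card_le (skewCells_subset hν.isRightmostHook)
      (hν.longest _ (isRightmostHook_strip h))
    have e1 : μ.cells \ skewCells μ ν = ν.cells :=
      Finset.sdiff_sdiff_eq_self (YoungDiagram.cells_subset_iff.2 hν.isRightmostHook.isRimHook.le)
    have e2 : μ.cells \ skewCells μ (stripDiagram m μ) = (stripDiagram m μ).cells :=
      Finset.sdiff_sdiff_eq_self
        (YoungDiagram.cells_subset_iff.2 (isRightmostHook_strip h).isRimHook.le)
    exact YoungDiagram.ext (by rw [← e1, ← e2, h1])
  · rintro rfl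
    exact ⟨isRightmostHook_strip h, fun ν' h' => Finset.card_le_card (skewCells_subset h')⟩

theorem exists_strip {m : ℕ} {μ : YoungDiagram} (h : m < μ.rowLen 0) : ∃ ν, IsStrip m μ ν :=
  ⟨_, (isStrip_iff h).2 rfl⟩

theorem IsStrip.card_lt {m : ℕ} {μ ν : YoungDiagram} (h : IsStrip m μ ν) : ν.card < μ.card := by
  obtain ⟨c, hc, -⟩ := h.isRightmostHook.rightmost
  have hc := Finset.mem_sdiff.1 hc
  exact Finset.card_lt_card ((Finset.ssubset_iff_of_subset
    (YoungDiagram.cells_subset_iff.2 h.isRightmostHook.isRimHook.le)).2 ⟨c, hc.1, hc.2⟩)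

/-- Strip away the longest rightmost rim hook of arm length `m`, and repeat until fewer than
`m + 1` columns remain. -/
noncomputable def residual (m : ℕ) (μ : YoungDiagram) : YoungDiagram :=
  if h : m < μ.rowLen 0 then residual m (exists_strip h).choose else μ
termination_by μ.card
decreasing_by exact (exists_strip h).choose_spec.card_lt

/-! ### The statistics -/

/-- The vertical side of the largest rectangle inside `μ` whose horizontal side exceeds its
vertical side by `a` (it is `0` if there is no nonempty such rectangle). For `a = 0` this is the
side of the Durfee square, for `a = 1` the vertical side of the Durfee rectangle. -/
noncomputable def durfeeSide (a : ℕ) (μ : YoungDiagram) : ℕ :=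
  sSup {k : ℕ | Finset.range k ×ˢ Finset.range (k + a) ⊆ μ.cells}

/-- The diagram formed by the cells of `μ` in the first `k` rows to the right of the first `l`
columns, moved `l` columns to the left. -/
def rightPart (k l : ℕ) (μ : YoungDiagram) : YoungDiagram where
  cells := μ.cells.filter fun c => c.1 < k ∧ (c.1, c.2 + l) ∈ μ
  isLowerSet := by
    rintro ⟨i, j⟩ ⟨i', j'⟩ ⟨hi, hj⟩ h
    simp only [Finset.coe_filter, Set.mem_ofPred_eq, YoungDiagram.mem_cells] at h ⊢
    simp only at hi hj
    exact ⟨μ.up_left_mem hi hj h.1, by omega, μ.up_left_mem hi (by omega) h.2.2⟩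

/-- The number of cells on the main diagonal. -/
def diagLength (μ : YoungDiagram) : ℕ := (μ.cells.filter fun c => c.1 = c.2).card

/-- The Frobenius coordinates `x₁, …, x_d` of `μ` (the number of cells in the `i`-th row to the
right of the diagonal cell, rows being counted from `1`), with `x_{d+1} = -1`. -/
def frobX (μ : YoungDiagram) (i : ℕ) : ℤ :=
  if i ≤ diagLength μ then (μ.rowLen (i - 1) : ℤ) - i else -1

/-- The Frobenius coordinates `y₁, …, y_d` of `μ` (the number of cells in the `i`-th column below
the diagonal cell, columns being counted from `1`), with `y₀ = n`. -/
def frobY (n : ℕ) (μ : YoungDiagram) (i : ℕ) : ℤ :=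
  if i = 0 then n else (μ.colLen (i - 1) : ℤ) - i

/-- `max_{0 ≤ i ≤ d} (y_i - x_{i+1}) - 1`, with `y₀ = n` and `x_{d+1} = -1`. -/
def frobeniusMax (n : ℕ) (μ : YoungDiagram) : ℤ :=
  (Finset.range (diagLength μ + 1)).sup' Finset.nonempty_range_add_one
    (fun i => frobY n μ i - frobX μ (i + 1)) - 1

/-- The statistic `f⁽ᵃ⁾` on diagrams. -/
noncomputable def durfeeRank (a : ℕ) (μ : YoungDiagram) : ℤ :=
  let n := durfeeSide a μ
  frobeniusMax n (residual (n + a) (rightPart n (n + a) μ))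

/-- The sqrank of a partition. -/
noncomputable def sqrank {n : ℕ} (p : n.Partition) : ℤ := durfeeRank 0 (ferrers p)

/-- The rerank of a partition. -/
noncomputable def rerank {n : ℕ} (p : n.Partition) : ℤ := durfeeRank 1 (ferrers p)

end OddEvenMex

namespace OddEvenMex

open YoungDiagram

/-! ### Young diagrams through row and column lengths -/

/-! Both parts are the cases a = 0, 1 of one statement, obtained by subtracting consecutive tail
counts. For every r, the partitions of n with mex at least 2r+1+a and those with f⁽ᵃ⁾ at least r are
both equinumerous with all diagrams of size n - r(r+a).

For the mex this is direct: the bound says that 1+a, 3+a, ..., 2r-1+a are parts. Their sum is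
r(r+a), and one copy of each can be removed or added (`ncard_partition_staircase`).

For the rank, a diagram is encoded by a triple (k, R, C): k is the Durfee side, R the residual
diagram, and C collects the rows below the rectangle (lengths at most k+a) and the stripped hooks
(lengths from k+a+1 to 2k+a). Stripping is reversible, so R ranges over all diagrams in a k × (k+a)
box and C over all multisets of positive integers up to 2k+a (`bijOn_durfeeCode`). The rank depends
on k and R alone.

The rank is at least r iff some y_i - x_{i+1} exceeds r. At the first such i, a reflection exchanges
the first i rows of R with its first i columns, moving r cells from each column to the corresponding
row. It preserves size, i can be read off the image, and the image is the set of all diagrams with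
at most k-r columns and k+a+r rows (`bijOn_reflectArms`). After transposition this is the box of a
code for k-r and a+2r. The bound 2k+a on C is unchanged, and k(k+a) = (k-r)(k+r+a) + r(r+a). Hence
the codes of rank at least r correspond to all codes for a+2r of weight n - r(r+a)
(`bijOn_reflectCode`), that is, to all diagrams of that size. -/

theorem lt_rowLen_iff_lt_colLen {μ : YoungDiagram} {i j : ℕ} : j < μ.rowLen i ↔ i < μ.colLen j := by
  rw [← mem_iff_lt_rowLen, mem_iff_lt_colLen]

theorem rowLen_le_iff_colLen_le {μ : YoungDiagram} {i j : ℕ} :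
    μ.rowLen i ≤ j ↔ μ.colLen j ≤ i := by
  simpa using (lt_rowLen_iff_lt_colLen (μ := μ) (i := i) (j := j)).not

theorem ext_rowLen {μ ν : YoungDiagram} (h : ∀ i, μ.rowLen i = ν.rowLen i) : μ = ν := by
  ext ⟨i, j⟩
  simp [mem_iff_lt_rowLen, h]

theorem ext_colLen {μ ν : YoungDiagram} (h : ∀ i, μ.colLen i = ν.colLen i) : μ = ν := by
  ext ⟨i, j⟩
  simp [mem_iff_lt_colLen, h]

theorem rowLen_eq_of_forall {μ : YoungDiagram} {i n : ℕ} (h : ∀ j, (i, j) ∈ μ ↔ j < n) :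
    μ.rowLen i = n := by
  refine le_antisymm ?_ ?_
  · have := (h n).not.2 (lt_irrefl n)
    rw [mem_iff_lt_rowLen] at this
    omega
  · by_contra! hlt
    have := (h _).2 hlt
    rw [mem_iff_lt_rowLen] at this
    omega

theorem colLen_eq_of_forall {μ : YoungDiagram} {j n : ℕ} (h : ∀ i, (i, j) ∈ μ ↔ i < n) :
    μ.colLen j = n := by
  rw [← rowLen_transpose]
  exact rowLen_eq_of_forall fun i => by simpa using h i

theorem exists_rowLen_eq (f : ℕ → ℕ) (hf : Antitone f) {N : ℕ} (hN : f N = 0) :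
    ∃ μ : YoungDiagram, ∀ i, μ.rowLen i = f i := by
  refine ⟨⟨(Finset.range N ×ˢ Finset.range (f 0)).filter fun c => c.2 < f c.1, ?_⟩, fun i => ?_⟩
  · rintro ⟨i, j⟩ ⟨i', j'⟩ ⟨hi, hj⟩ h
    simp only [Finset.coe_filter, Finset.mem_product, Finset.mem_range, Set.mem_ofPred_eq] at h hi hj ⊢
    have := hf hi
    omega
  · refine rowLen_eq_of_forall fun j => ?_
    rw [← mem_cells, Finset.mem_filter, Finset.mem_product, Finset.mem_range, Finset.mem_range]
    refine ⟨fun h => h.2, fun h => ⟨⟨?_, h.trans_le (hf (Nat.zero_le i))⟩, h⟩⟩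
    by_contra! hi
    have : f i ≤ f N := hf hi
    omega

theorem exists_colLen_eq (f : ℕ → ℕ) (hf : Antitone f) {N : ℕ} (hN : f N = 0) :
    ∃ μ : YoungDiagram, ∀ i, μ.colLen i = f i := by
  obtain ⟨μ, hμ⟩ := exists_rowLen_eq f hf hN
  exact ⟨μ.transpose, fun i => by rw [colLen_transpose, hμ]⟩

theorem rowLen_eq_zero_of_le {μ : YoungDiagram} {i : ℕ} (h : μ.colLen 0 ≤ i) : μ.rowLen i = 0 :=
  Nat.le_zero.1 (rowLen_le_iff_colLen_le.2 h)

theorem colLen_eq_zero_of_le {μ : YoungDiagram} {j : ℕ} (h : μ.rowLen 0 ≤ j) : μ.colLen j = 0 :=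
  Nat.le_zero.1 (rowLen_le_iff_colLen_le.1 h)

theorem card_eq_sum_rowLen {μ : YoungDiagram} {N : ℕ} (h : μ.colLen 0 ≤ N) :
    μ.card = ∑ i ∈ Finset.range N, μ.rowLen i := by
  rw [YoungDiagram.card, Finset.card_eq_sum_card_fiberwise (f := Prod.fst) (t := Finset.range N)]
  · exact Finset.sum_congr rfl fun i _ => (rowLen_eq_card μ).symm
  · rintro ⟨i, j⟩ hc
    have hc : (i, j) ∈ μ := by simpa using hc
    have := mem_iff_lt_colLen.1 (μ.up_left_mem le_rfl (Nat.zero_le _) hc)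
    simp only [Finset.coe_range, Set.mem_Iio]
    omega

theorem card_transpose (μ : YoungDiagram) : μ.transpose.card = μ.card :=
  Finset.card_bij' (fun c _ => c.swap) (fun c _ => c.swap) (by simp [mem_transpose])
    (by simp [mem_transpose]) (by simp) (by simp)

theorem card_eq_sum_colLen {μ : YoungDiagram} {N : ℕ} (h : μ.rowLen 0 ≤ N) :
    μ.card = ∑ i ∈ Finset.range N, μ.colLen i := by
  rw [← card_transpose, card_eq_sum_rowLen (N := N) (by rwa [colLen_transpose])]
  simp

/-! ### The multiset of parts of a diagram -/

/-- The multiset of the nonzero row lengths. -/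
def partsOf (μ : YoungDiagram) : Multiset ℕ := (μ.rowLens : Multiset ℕ)

theorem partsOf_injective : Function.Injective partsOf := by
  intro μ ν h
  have h' : μ.rowLens = ν.rowLens :=
    (Multiset.coe_eq_coe.1 h).eq_of_sortedGE μ.rowLens_sorted ν.rowLens_sorted
  exact equivListRowLens.injective (Subtype.ext h')

theorem partsOf_ofRowLens_sort {s : Multiset ℕ} (hs : ∀ x ∈ s, 0 < x) :
    partsOf (ofRowLens (s.sort (· ≥ ·)) (s.pairwise_sort (· ≥ ·)).sortedGE) = s := by
  rw [partsOf, rowLens_ofRowLens_eq_self (by simpa using hs), Multiset.sort_eq]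

theorem exists_partsOf_eq {s : Multiset ℕ} (hs : ∀ x ∈ s, 0 < x) : ∃ μ, partsOf μ = s :=
  ⟨_, partsOf_ofRowLens_sort hs⟩

theorem sum_partsOf (μ : YoungDiagram) : (partsOf μ).sum = μ.card := by
  rw [card_eq_sum_rowLen le_rfl, partsOf, Multiset.sum_coe, rowLens]
  rfl

theorem mem_partsOf {μ : YoungDiagram} {x : ℕ} : x ∈ partsOf μ ↔ 0 < x ∧ ∃ i, μ.rowLen i = x := by
  simp only [partsOf, Multiset.mem_coe, rowLens, List.mem_map, List.mem_range]
  refine ⟨?_, ?_⟩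
  · rintro ⟨i, hi, rfl⟩
    exact ⟨lt_rowLen_iff_lt_colLen.2 hi, i, rfl⟩
  · rintro ⟨h, i, rfl⟩
    exact ⟨i, lt_rowLen_iff_lt_colLen.1 h, rfl⟩

theorem le_of_mem_partsOf {μ : YoungDiagram} {x l : ℕ} (h : μ.rowLen 0 ≤ l) (hx : x ∈ partsOf μ) :
    x ≤ l := by
  obtain ⟨-, i, rfl⟩ := mem_partsOf.1 hx
  exact (μ.rowLen_anti 0 i (Nat.zero_le i)).trans h

theorem rowLen_zero_le_of_partsOf {μ : YoungDiagram} {l : ℕ} (h : ∀ x ∈ partsOf μ, x ≤ l) :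
    μ.rowLen 0 ≤ l := by
  rcases Nat.eq_zero_or_pos (μ.rowLen 0) with h0 | h0
  · omega
  · exact h _ (mem_partsOf.2 ⟨h0, 0, rfl⟩)

theorem partsOf_ferrers {n : ℕ} (p : n.Partition) : partsOf (ferrers p) = p.parts :=
  partsOf_ofRowLens_sort fun _ hx => p.parts_pos hx

/-- Partitions of `n` correspond to Young diagrams with `n` cells. -/
theorem ferrers_bijOn (n : ℕ) :
    Set.BijOn (ferrers (n := n)) Set.univ {μ : YoungDiagram | μ.card = n} := by
  refine ⟨fun p _ => ?_, fun p _ q _ h => ?_, fun μ hμ => ?_⟩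
  · simp [← sum_partsOf, partsOf_ferrers, p.parts_sum]
  · exact Nat.Partition.ext (by rw [← partsOf_ferrers, h, partsOf_ferrers])
  · refine ⟨⟨partsOf μ, fun hi => (mem_partsOf.1 hi).1, by rw [sum_partsOf]; exact hμ⟩,
      Set.mem_univ _, partsOf_injective ?_⟩
    rw [partsOf_ferrers]

/-! ### Stripping rim hooks -/

theorem residual_eq_self {m : ℕ} {μ : YoungDiagram} (h : μ.rowLen 0 ≤ m) : residual m μ = μ := by
  rw [residual, dif_neg (by omega)]

theorem residual_eq_residual_strip {m : ℕ} {μ : YoungDiagram} (h : m < μ.rowLen 0) :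
    residual m μ = residual m (stripDiagram m μ) := by
  rw [residual, dif_pos h, (isStrip_iff h).1 (exists_strip h).choose_spec]

theorem card_strip_lt {m : ℕ} {μ : YoungDiagram} (h : m < μ.rowLen 0) :
    (stripDiagram m μ).card < μ.card :=
  ((isStrip_iff h).2 rfl).card_lt

theorem mem_stripDiagram {m : ℕ} {μ : YoungDiagram} {i j : ℕ} : (i, j) ∈ stripDiagram m μ ↔
    (i, j) ∈ μ ∧ (j + (m + 1) < μ.rowLen 0 ∨ (i + 1, j + 1) ∈ μ) :=
  Finset.mem_filter

theorem colLen_strip_of_lt {m : ℕ} {μ : YoungDiagram} {j : ℕ} (hj : j + (m + 1) < μ.rowLen 0) :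
    (stripDiagram m μ).colLen j = μ.colLen j := by
  refine colLen_eq_of_forall fun i => ?_
  rw [mem_stripDiagram, and_iff_left (Or.inl hj), mem_iff_lt_colLen]

/-- A cell of such a column survives iff its lower right neighbour is in `μ`, so the new column is
the next old one moved up and to the left by one. -/
theorem colLen_strip_of_le {m : ℕ} {μ : YoungDiagram} {j : ℕ} (hj : μ.rowLen 0 ≤ j + (m + 1)) :
    (stripDiagram m μ).colLen j = μ.colLen (j + 1) - 1 := by
  refine colLen_eq_of_forall fun i => ?_
  rw [mem_stripDiagram, or_iff_right hj.not_gt, mem_iff_lt_colLen, mem_iff_lt_colLen]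
  have := μ.colLen_anti j (j + 1) (by omega)
  omega

/-- The multiset of the heights (numbers of rows) of the rim hooks that are stripped away. -/
noncomputable def heights (m : ℕ) (μ : YoungDiagram) : Multiset ℕ :=
  if h : m < μ.rowLen 0 then
    μ.colLen (μ.rowLen 0 - (m + 1)) ::ₘ heights m (stripDiagram m μ)
  else 0
termination_by μ.card
decreasing_by exact card_strip_lt h

theorem heights_eq_zero {m : ℕ} {μ : YoungDiagram} (h : μ.rowLen 0 ≤ m) : heights m μ = 0 := by
  rw [heights, dif_neg (by omega)]

theorem heights_eq_cons {m : ℕ} {μ : YoungDiagram} (h : m < μ.rowLen 0) :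
    heights m μ = μ.colLen (μ.rowLen 0 - (m + 1)) ::ₘ heights m (stripDiagram m μ) := by
  rw [heights, dif_pos h]

/-- Induction along the stripping process. -/
theorem strip_induction (m : ℕ) {P : YoungDiagram → Prop}
    (base : ∀ μ, μ.rowLen 0 ≤ m → P μ)
    (step : ∀ μ, m < μ.rowLen 0 → P (stripDiagram m μ) → P μ) (μ : YoungDiagram) : P μ := by
  by_cases h : m < μ.rowLen 0
  · exact step μ h (strip_induction m base step _)
  · exact base μ (by omega)
termination_by μ.card
decreasing_by exact card_strip_lt h

theorem colLen_strip_le (m : ℕ) (μ : YoungDiagram) (j : ℕ) :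
    (stripDiagram m μ).colLen j ≤ μ.colLen j := by
  rcases lt_or_ge (j + (m + 1)) (μ.rowLen 0) with hj | hj
  · rw [colLen_strip_of_lt hj]
  · rw [colLen_strip_of_le hj]
    have := μ.colLen_anti j (j + 1) (by omega)
    omega

theorem rowLen_strip_lt {m : ℕ} {μ : YoungDiagram} (h : m < μ.rowLen 0) :
    (stripDiagram m μ).rowLen 0 < μ.rowLen 0 := by
  have : (stripDiagram m μ).rowLen 0 ≤ μ.rowLen 0 - 1 := by
    rw [rowLen_le_iff_colLen_le, colLen_strip_of_le (by omega), colLen_eq_zero_of_le (by omega)]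
  omega

/-- Successive hooks begin further and further left, each in a column untouched by its predecessor,
so their heights weakly increase. This is why the multiset of heights determines their order. -/
theorem colLen_le_colLen_strip {m : ℕ} {μ : YoungDiagram} (h : m < (stripDiagram m μ).rowLen 0)
    (hμ : m < μ.rowLen 0) :
    μ.colLen (μ.rowLen 0 - (m + 1)) ≤
      (stripDiagram m μ).colLen ((stripDiagram m μ).rowLen 0 - (m + 1)) := by
  have := rowLen_strip_lt hμ
  rw [colLen_strip_of_lt (by omega)]
  exact μ.colLen_anti _ _ (by omega)

theorem le_of_mem_heights {m : ℕ} {μ : YoungDiagram} {x : ℕ} (hx : x ∈ heights m μ) :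
    μ.colLen (μ.rowLen 0 - (m + 1)) ≤ x := by
  induction μ using strip_induction m with
  | base μ h => simp [heights_eq_zero h] at hx
  | step μ h ih =>
    rw [heights_eq_cons h, Multiset.mem_cons] at hx
    rcases hx with rfl | hx
    · rfl
    · refine (colLen_le_colLen_strip ?_ h).trans (ih hx)
      by_contra! hle
      simp [heights_eq_zero hle] at hx

theorem pos_of_mem_heights {m : ℕ} {μ : YoungDiagram} {x : ℕ} (hx : x ∈ heights m μ) : 0 < x := by
  have h : m < μ.rowLen 0 := by
    by_contra! hle
    simp [heights_eq_zero hle] at hx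
  refine lt_of_lt_of_le ?_ (le_of_mem_heights hx)
  exact lt_rowLen_iff_lt_colLen.1 (by omega)

theorem heights_le {m k : ℕ} {μ : YoungDiagram} (hk : μ.colLen 0 ≤ k) {x : ℕ}
    (hx : x ∈ heights m μ) : x ≤ k := by
  induction μ using strip_induction m with
  | base μ h => simp [heights_eq_zero h] at hx
  | step μ h ih =>
    rw [heights_eq_cons h, Multiset.mem_cons] at hx
    rcases hx with rfl | hx
    · exact (μ.colLen_anti 0 _ (Nat.zero_le _)).trans hk
    · exact ih ((colLen_strip_le m μ 0).trans hk) hx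

theorem rowLen_residual_le (m : ℕ) (μ : YoungDiagram) : (residual m μ).rowLen 0 ≤ m := by
  induction μ using strip_induction m with
  | base μ h => rwa [residual_eq_self h]
  | step μ h ih => rwa [residual_eq_residual_strip h]

theorem colLen_residual_le (m : ℕ) (μ : YoungDiagram) (j : ℕ) :
    (residual m μ).colLen j ≤ μ.colLen j := by
  induction μ using strip_induction m with
  | base μ h => rw [residual_eq_self h]
  | step μ h ih => rw [residual_eq_residual_strip h]; exact ih.trans (colLen_strip_le m μ j)

/-- A rim hook with h rows and m + 1 columns has h + m cells. -/
theorem card_eq_card_strip_add {m : ℕ} {μ : YoungDiagram} (h : m < μ.rowLen 0) :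
    μ.card = (stripDiagram m μ).card + (μ.colLen (μ.rowLen 0 - (m + 1)) + m) := by
  obtain ⟨p, hp⟩ : ∃ p, μ.rowLen 0 = p + (1 + m) := ⟨μ.rowLen 0 - (1 + m), by omega⟩
  have hs := rowLen_strip_lt h
  rw [card_eq_sum_colLen (le_of_eq hp), card_eq_sum_colLen (N := p + m) (by omega),
    Finset.sum_range_add, Finset.sum_range_add, Finset.sum_range_add,
    show μ.rowLen 0 - (m + 1) = p by omega]
  have h1 : ∑ x ∈ Finset.range p, (stripDiagram m μ).colLen x =
      ∑ x ∈ Finset.range p, μ.colLen x :=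
    Finset.sum_congr rfl fun x hx => colLen_strip_of_lt (by
      have := Finset.mem_range.1 hx
      omega)
  -- Each of the last m columns of `μ` loses one cell and moves one place to the left; the column p,
  -- whose length is the height of the hook, is overwritten.
  have h2 : ∑ x ∈ Finset.range m, μ.colLen (p + (1 + x)) =
      ∑ x ∈ Finset.range m, (stripDiagram m μ).colLen (p + x) + m := by
    have h3 : ∑ x ∈ Finset.range m, 1 = m := by simp
    refine Eq.trans ?_ (congrArg _ h3)
    rw [← Finset.sum_add_distrib]
    refine Finset.sum_congr rfl fun x hx => ?_
    have := Finset.mem_range.1 hx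
    rw [colLen_strip_of_le (by omega)]
    have : 0 < μ.colLen (p + x + 1) := lt_rowLen_iff_lt_colLen.1 (by omega)
    rw [← add_assoc, add_right_comm]
    omega
  simp only [Finset.range_one, Finset.sum_singleton, add_zero]
  omega

theorem card_eq_card_residual_add (m : ℕ) (μ : YoungDiagram) :
    μ.card = (residual m μ).card + ((heights m μ).map (· + m)).sum := by
  induction μ using strip_induction m with
  | base μ h => simp [residual_eq_self h, heights_eq_zero h]
  | step μ h ih =>
    rw [card_eq_card_strip_add h, residual_eq_residual_strip h, heights_eq_cons h,
      Multiset.map_cons, Multiset.sum_cons, ih]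
    omega

/-- A diagram is determined by the result of stripping a hook and by the height of the hook. -/
theorem eq_of_strip_eq {m : ℕ} {μ ν : YoungDiagram} (hμ : m < μ.rowLen 0) (hν : m < ν.rowLen 0)
    (h : stripDiagram m μ = stripDiagram m ν)
    (hh : μ.colLen (μ.rowLen 0 - (m + 1)) = ν.colLen (ν.rowLen 0 - (m + 1))) : μ = ν := by
  -- The hooks begin in the same column. If the hook of `μ` began further left, at q, then column q
  -- of the common strip would have fewer cells than the hook's height seen from `μ`, but at least
  -- that many seen from `ν`.
  have key : ∀ μ ν : YoungDiagram, m < μ.rowLen 0 → m < ν.rowLen 0 →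
      stripDiagram m μ = stripDiagram m ν →
      μ.colLen (μ.rowLen 0 - (m + 1)) = ν.colLen (ν.rowLen 0 - (m + 1)) →
      ¬ μ.rowLen 0 < ν.rowLen 0 := by
    intro μ ν hμ hν h hh hlt
    have h1 := colLen_strip_of_lt (m := m) (μ := ν) (j := μ.rowLen 0 - (m + 1)) (by omega)
    rw [← h, colLen_strip_of_le (by omega)] at h1
    have h2 := ν.colLen_anti (μ.rowLen 0 - (m + 1)) (ν.rowLen 0 - (m + 1)) (by omega)
    have h3 := μ.colLen_anti (μ.rowLen 0 - (m + 1)) (μ.rowLen 0 - (m + 1) + 1) (by omega)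
    have h4 : 0 < μ.colLen (μ.rowLen 0 - (m + 1)) := lt_rowLen_iff_lt_colLen.1 (by omega)
    omega
  have hN : μ.rowLen 0 = ν.rowLen 0 := by
    have := key μ ν hμ hν h hh
    have := key ν μ hν hμ h.symm hh.symm
    omega
  refine ext_colLen fun j => ?_
  rcases lt_trichotomy j (μ.rowLen 0 - (m + 1)) with hj | rfl | hj
  · rw [← colLen_strip_of_lt (m := m) (μ := μ) (by omega), h, colLen_strip_of_lt (by omega)]
  · rw [hh, hN]
  · rcases lt_or_ge j (μ.rowLen 0) with hj' | hj'
    · obtain ⟨j, rfl⟩ : ∃ i, j = i + 1 := ⟨j - 1, by omega⟩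
      have h1 := colLen_strip_of_le (m := m) (μ := μ) (j := j) (by omega)
      have h2 := colLen_strip_of_le (m := m) (μ := ν) (j := j) (by omega)
      have h3 : 0 < μ.colLen (j + 1) := lt_rowLen_iff_lt_colLen.1 hj'
      have h4 : 0 < ν.colLen (j + 1) := lt_rowLen_iff_lt_colLen.1 (by omega)
      rw [h] at h1
      omega
    · rw [colLen_eq_zero_of_le hj', colLen_eq_zero_of_le (by omega)]

/-- The first hook stripped has the smallest height in the multiset, so the two processes start with
equal heights and can be undone in parallel. -/
theorem eq_of_residual_eq_of_heights_eq {m : ℕ} {μ ν : YoungDiagram}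
    (hr : residual m μ = residual m ν) (hh : heights m μ = heights m ν) : μ = ν := by
  induction μ using strip_induction m generalizing ν with
  | base μ h =>
    rw [heights_eq_zero h] at hh
    have h' : ν.rowLen 0 ≤ m := by
      by_contra! hlt
      rw [heights_eq_cons hlt] at hh
      exact Multiset.cons_ne_zero hh.symm
    rwa [residual_eq_self h, residual_eq_self h'] at hr
  | step μ h ih =>
    have h' : m < ν.rowLen 0 := by
      by_contra! hle
      rw [heights_eq_cons h, heights_eq_zero hle] at hh
      exact Multiset.cons_ne_zero hh
    have e : μ.colLen (μ.rowLen 0 - (m + 1)) = ν.colLen (ν.rowLen 0 - (m + 1)) := by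
      refine le_antisymm (le_of_mem_heights ?_) (le_of_mem_heights ?_)
      · rw [hh, heights_eq_cons h']
        exact Multiset.mem_cons_self _ _
      · rw [← hh, heights_eq_cons h]
        exact Multiset.mem_cons_self _ _
    rw [residual_eq_residual_strip h, residual_eq_residual_strip h'] at hr
    rw [heights_eq_cons h, heights_eq_cons h', e, Multiset.cons_inj_right] at hh
    exact eq_of_strip_eq h h' (ih hr hh) e

/-- Rim hooks can be glued back. -/
theorem exists_strip_eq {m k h : ℕ} {ν : YoungDiagram} (hk : ν.colLen 0 ≤ k) (h0 : 0 < h)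
    (hhk : h ≤ k) (hν : m < ν.rowLen 0 → h ≤ ν.colLen (ν.rowLen 0 - (m + 1))) :
    ∃ μ : YoungDiagram, μ.colLen 0 ≤ k ∧ m < μ.rowLen 0 ∧
      μ.colLen (μ.rowLen 0 - (m + 1)) = h ∧ stripDiagram m μ = ν := by
  -- p is the first column of `ν` with fewer than h cells, the only place where a hook of height h
  -- can begin.
  obtain ⟨p, hp⟩ : ∃ p, p = ν.rowLen (h - 1) := ⟨_, rfl⟩
  have hlt : ∀ j, j < p ↔ h ≤ ν.colLen j := fun j => by
    rw [hp, lt_rowLen_iff_lt_colLen]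
    omega
  have hle : ν.rowLen 0 ≤ p + m := by
    rcases lt_or_ge m (ν.rowLen 0) with hm | hm
    · have := (hlt _).2 (hν hm)
      omega
    · omega
  -- This inverts the column formulas for stripping: a column of length h is inserted at p, and the
  -- columns of `ν` from p on move right and gain a cell each. Some of those may be empty columns of
  -- `ν`.
  obtain ⟨μ, hμ⟩ := exists_colLen_eq (N := p + m + 1) (fun j => if j < p then ν.colLen j else
    if j = p then h else if j ≤ p + m then ν.colLen (j - 1) + 1 else 0) (by
      refine antitone_nat_of_succ_le fun j => ?_
      have h1 := hlt j
      have h2 := ν.colLen_anti j (j + 1) (by omega)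
      have h3 := ν.colLen_anti (j - 1) j (by omega)
      have h4 := Nat.add_sub_cancel (n := j) (m := 1)
      simp only [h4]
      split_ifs <;> omega) (by
      split_ifs <;> omega)
  have hN : μ.rowLen 0 = p + m + 1 := by
    refine rowLen_eq_of_forall fun j => ?_
    rw [mem_iff_lt_colLen, hμ]
    have := hlt j
    split_ifs <;> omega
  have hNp : μ.rowLen 0 - (m + 1) = p := by omega
  refine ⟨μ, ?_, by omega, ?_, ?_⟩
  · rw [hμ]
    have h1 := hlt 0
    split_ifs <;> omega
  · rw [hNp, hμ, if_neg (lt_irrefl p), if_pos rfl]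
  · refine ext_colLen fun j => ?_
    rcases lt_or_ge j p with hj | hj
    · rw [colLen_strip_of_lt (by omega), hμ, if_pos hj]
    · rw [colLen_strip_of_le (by omega), hμ]
      have h1 : p + m ≤ j → ν.colLen j = 0 := fun h => colLen_eq_zero_of_le (by omega)
      rw [Nat.add_sub_cancel]
      split_ifs <;> omega

/-- Hooks are glued in order of decreasing height, the reverse of the order of stripping; the list
is increasing, so its tail is glued first. -/
theorem exists_residual_eq_heights_eq {m k : ℕ} {ρ : YoungDiagram} (hk : ρ.colLen 0 ≤ k)
    (hm : ρ.rowLen 0 ≤ m) {s : Multiset ℕ} (hs : ∀ x ∈ s, 0 < x ∧ x ≤ k) :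
    ∃ μ : YoungDiagram, μ.colLen 0 ≤ k ∧ residual m μ = ρ ∧ heights m μ = s := by
  suffices H : ∀ l : List ℕ, l.Pairwise (· ≤ ·) → (∀ x ∈ l, 0 < x ∧ x ≤ k) →
      ∃ μ : YoungDiagram, μ.colLen 0 ≤ k ∧ residual m μ = ρ ∧ heights m μ = l by
    obtain ⟨μ, hμ⟩ := H (s.sort (· ≤ ·)) (s.pairwise_sort (· ≤ ·)) (by simpa using hs)
    exact ⟨μ, by simpa using hμ⟩
  intro l
  induction l with
  | nil => exact fun _ _ => ⟨ρ, hk, residual_eq_self hm, heights_eq_zero hm⟩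
  | cons h l ih =>
    intro hl hpos
    obtain ⟨ν, hν, hr, hh⟩ := ih hl.of_cons fun x hx => hpos x (List.mem_cons_of_mem _ hx)
    obtain ⟨h0, hhk⟩ := hpos h List.mem_cons_self
    obtain ⟨μ, h1, h2, h3, h4⟩ := exists_strip_eq (m := m) hν h0 hhk fun hlt => by
      refine List.rel_of_pairwise_cons hl ?_
      rw [← Multiset.mem_coe, ← hh, heights_eq_cons hlt]
      exact Multiset.mem_cons_self _ _
    refine ⟨μ, h1, ?_, ?_⟩
    · rw [residual_eq_residual_strip h2, h4, hr]
    · rw [heights_eq_cons h2, h3, h4, hh, Multiset.cons_coe]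


/-! ### Removing the first rows -/

/-- The diagram formed by all rows but the first `k`. -/
def lowerPart (k : ℕ) (μ : YoungDiagram) : YoungDiagram where
  cells := μ.cells.filter fun c => (c.1 + k, c.2) ∈ μ
  isLowerSet := by
    rintro ⟨i, j⟩ ⟨i', j'⟩ ⟨hi, hj⟩ h
    simp only [Finset.coe_filter, Set.mem_ofPred_eq, YoungDiagram.mem_cells] at h ⊢
    simp only at hi hj
    exact ⟨μ.up_left_mem hi hj h.1, μ.up_left_mem (by omega) hj h.2⟩

theorem mem_lowerPart {k : ℕ} {μ : YoungDiagram} {i j : ℕ} :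
    (i, j) ∈ lowerPart k μ ↔ (i + k, j) ∈ μ :=
  Finset.mem_filter.trans
    ⟨fun h => h.2, fun h => ⟨(mem_cells _).2 (μ.up_left_mem (by omega) le_rfl h), h⟩⟩

theorem rowLen_lowerPart (k : ℕ) (μ : YoungDiagram) (i : ℕ) :
    (lowerPart k μ).rowLen i = μ.rowLen (i + k) :=
  rowLen_eq_of_forall fun j => by rw [mem_lowerPart, mem_iff_lt_rowLen]

theorem colLen_lowerPart (k : ℕ) (μ : YoungDiagram) (j : ℕ) :
    (lowerPart k μ).colLen j = μ.colLen j - k :=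
  colLen_eq_of_forall fun i => by
    rw [mem_lowerPart, mem_iff_lt_colLen]
    omega

theorem card_eq_sum_add_card_lowerPart (k : ℕ) (μ : YoungDiagram) :
    μ.card = ∑ i ∈ Finset.range k, μ.rowLen i + (lowerPart k μ).card := by
  rw [card_eq_sum_rowLen (N := k + μ.colLen 0) (by omega),
    card_eq_sum_rowLen (μ := lowerPart k μ) (N := μ.colLen 0) (by rw [colLen_lowerPart]; omega),
    Finset.sum_range_add]
  simp only [rowLen_lowerPart, add_comm]

/-- The diagram formed by the cells that are neither in the first `i` rows nor in the first `i`
columns. -/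
def innerPart (i : ℕ) (μ : YoungDiagram) : YoungDiagram := lowerPart i (lowerPart i μ).transpose

theorem card_eq_sum_add_card_innerPart (i : ℕ) (μ : YoungDiagram) :
    μ.card = ∑ p ∈ Finset.range i, μ.rowLen p + ∑ p ∈ Finset.range i, (μ.colLen p - i) +
      (innerPart i μ).card := by
  rw [card_eq_sum_add_card_lowerPart i μ, ← card_transpose (lowerPart i μ),
    card_eq_sum_add_card_lowerPart i (lowerPart i μ).transpose, innerPart, add_assoc]
  simp [colLen_lowerPart]

/-! ### Exchanging arms and legs -/

/-- The condition under which `swapArms i r` acts well on `μ`. -/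
structure Swappable (i r : ℕ) (μ : YoungDiagram) : Prop where
  -- The first two conditions make the new row p, of length `μ.colLen p - r`, at least i and at
  -- least as long as row i. The last two play this role for the new columns. The swap exchanges the
  -- two pairs, which makes it an involution.
  le_colLen : ∀ p < i, i + r ≤ μ.colLen p
  rowLen_le : ∀ p < i, μ.rowLen i + r ≤ μ.colLen p
  le_rowLen : ∀ p < i, i ≤ μ.rowLen p
  colLen_le : ∀ p < i, μ.colLen i ≤ μ.rowLen p + r

/-- The cells of the diagram in which the lengths of the first `i` rows become the lengths of the
first `i` columns of `μ`, diminished by `r`, and those of the first `i` columns become the lengths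
of the first `i` rows of `μ`, increased by `r`. -/
def IsSwappedCell (i r : ℕ) (μ : YoungDiagram) (c : ℕ × ℕ) : Prop :=
  if c.1 < i then c.2 < i ∨ c.2 + r < μ.colLen c.1
  else if c.2 < i then c.1 < μ.rowLen c.2 + r else c ∈ μ

/-- Exchange the first `i` rows and columns of `μ`, up to a shift by `r`. -/
noncomputable def swapArms (i r : ℕ) (μ : YoungDiagram) : YoungDiagram where
  -- Quantifying over all `c' ≤ c` makes this a lower set for every `μ`; for a swappable `μ` the
  -- condition at `c` alone suffices. The bounding square only ensures finiteness.
  cells := @Finset.filter _ (fun c => ∀ c' ≤ c, IsSwappedCell i r μ c') (fun _ => Classical.propDecidable _)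
    (Finset.range (i + μ.rowLen 0 + μ.colLen 0 + r) ×ˢ
      Finset.range (i + μ.rowLen 0 + μ.colLen 0 + r))
  isLowerSet := by
    rintro c c' hc h
    simp only [Finset.coe_filter, Set.mem_ofPred_eq, Finset.mem_product, Finset.mem_range] at h ⊢
    exact ⟨⟨hc.1.trans_lt h.1.1, hc.2.trans_lt h.1.2⟩, fun c'' hc'' => h.2 c'' (hc''.trans hc)⟩

section Arms

variable {i r k l : ℕ} {μ : YoungDiagram}

theorem Swappable.isSwappedCell_of_le (h : Swappable i r μ) {p q p' q' : ℕ} (hp : p' ≤ p)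
    (hq : q' ≤ q) (hc : IsSwappedCell i r μ (p, q)) : IsSwappedCell i r μ (p', q') := by
  have h1 := h.le_colLen p'
  have h2 := h.rowLen_le p'
  have h3 := h.le_rowLen q'
  have h4 := h.colLen_le q'
  have h5 := μ.colLen_anti p' p hp
  have h6 := μ.rowLen_anti q' q hq
  simp only [IsSwappedCell] at hc ⊢
  split_ifs at hc ⊢ with a b c d e f <;> try omega
  · rw [mem_iff_lt_rowLen] at hc
    have := μ.rowLen_anti i p (by omega)
    omega
  · rw [mem_iff_lt_colLen] at hc
    have := μ.colLen_anti i q (by omega)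
    omega
  · exact μ.up_left_mem hp hq hc

theorem Swappable.mem_swapArms (h : Swappable i r μ) {p q : ℕ} :
    (p, q) ∈ swapArms i r μ ↔ IsSwappedCell i r μ (p, q) := by
  classical
  refine Finset.mem_filter.trans ⟨fun hc => hc.2 _ le_rfl, fun hc =>
    ⟨?_, fun c' hc' => h.isSwappedCell_of_le hc'.1 hc'.2 hc⟩⟩
  simp only [Finset.mem_product, Finset.mem_range]
  have h1 := μ.colLen_anti 0 p (Nat.zero_le _)
  have h2 := μ.rowLen_anti 0 q (Nat.zero_le _)
  have h3 := μ.colLen_anti 0 q (Nat.zero_le _)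
  have h4 := μ.rowLen_anti 0 p (Nat.zero_le _)
  simp only [IsSwappedCell] at hc
  split_ifs at hc
  · omega
  · omega
  · have h5 := mem_iff_lt_rowLen.1 hc
    have h6 := mem_iff_lt_colLen.1 hc
    omega

theorem Swappable.rowLen_swapArms (h : Swappable i r μ) {p : ℕ} (hp : p < i) :
    (swapArms i r μ).rowLen p = μ.colLen p - r := by
  refine rowLen_eq_of_forall fun q => ?_
  have := h.le_colLen p hp
  simp only [h.mem_swapArms, IsSwappedCell, hp, if_true]
  omega

theorem Swappable.colLen_swapArms (h : Swappable i r μ) {q : ℕ} (hq : q < i) :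
    (swapArms i r μ).colLen q = μ.rowLen q + r := by
  refine colLen_eq_of_forall fun p => ?_
  have := h.le_rowLen q hq
  simp only [h.mem_swapArms, IsSwappedCell, hq, if_true, true_or]
  split_ifs <;> first | (simp; done) | omega | (simp; omega)

theorem Swappable.mem_swapArms_of_le (h : Swappable i r μ) {p q : ℕ} (hp : i ≤ p) (hq : i ≤ q) :
    (p, q) ∈ swapArms i r μ ↔ (p, q) ∈ μ := by
  simp only [h.mem_swapArms, IsSwappedCell, hp.not_gt, hq.not_gt, if_false]

/-- A bound n ≥ i concerns the cell (i, n), which the swap leaves alone. Smaller bounds would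
involve the exchanged columns. -/
theorem Swappable.rowLen_swapArms_le (h : Swappable i r μ) {n : ℕ} (hn : i ≤ n) :
    (swapArms i r μ).rowLen i ≤ n ↔ μ.rowLen i ≤ n := by
  have := (h.mem_swapArms_of_le le_rfl hn).not
  simpa [mem_iff_lt_rowLen] using this

theorem Swappable.colLen_swapArms_le (h : Swappable i r μ) {n : ℕ} (hn : i ≤ n) :
    (swapArms i r μ).colLen i ≤ n ↔ μ.colLen i ≤ n := by
  have := (h.mem_swapArms_of_le hn le_rfl).not
  simpa [mem_iff_lt_colLen] using this

theorem Swappable.swapArms (h : Swappable i r μ) : Swappable i r (swapArms i r μ) := by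
  refine ⟨fun p hp => ?_, fun p hp => ?_, fun p hp => ?_, fun p hp => ?_⟩ <;>
    have h1 := h.le_colLen p hp <;> have h2 := h.le_rowLen p hp
  · rw [h.colLen_swapArms hp]
    omega
  · rw [h.colLen_swapArms hp, add_le_add_iff_right, h.rowLen_swapArms_le h2]
    exact μ.rowLen_anti p i hp.le
  · rw [h.rowLen_swapArms hp]
    omega
  · rw [h.rowLen_swapArms hp, h.colLen_swapArms_le (by omega)]
    have := μ.colLen_anti p i hp.le
    omega

theorem Swappable.swapArms_swapArms (h : Swappable i r μ) :
    OddEvenMex.swapArms i r (OddEvenMex.swapArms i r μ) = μ := by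
  ext ⟨p, q⟩
  rw [mem_cells, mem_cells, h.swapArms.mem_swapArms, IsSwappedCell]
  split_ifs with hp hq
  · rw [h.colLen_swapArms hp, mem_iff_lt_rowLen]
    have := h.le_rowLen p hp
    simp only
    omega
  · rw [h.rowLen_swapArms hq, mem_iff_lt_colLen]
    have := h.le_colLen q hq
    simp only
    omega
  · exact h.mem_swapArms_of_le (by omega) (by omega)

/-- The inner part is unchanged, and for each p < i the sum of the lengths of row p and column p is
preserved, since the shifts by r cancel. -/
theorem Swappable.card_swapArms (h : Swappable i r μ) :
    (OddEvenMex.swapArms i r μ).card = μ.card := by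
  have hinner : innerPart i (OddEvenMex.swapArms i r μ) = innerPart i μ := by
    ext ⟨p, q⟩
    simp only [innerPart, mem_cells, mem_lowerPart, mem_transpose, Prod.swap_prod_mk]
    exact h.mem_swapArms_of_le (by omega) (by omega)
  rw [card_eq_sum_add_card_innerPart i μ, card_eq_sum_add_card_innerPart i, hinner,
    ← Finset.sum_add_distrib, ← Finset.sum_add_distrib]
  congr 1
  refine Finset.sum_congr rfl fun p hp => ?_
  have hp := Finset.mem_range.1 hp
  have h1 := h.le_colLen p hp
  have h2 := h.le_rowLen p hp
  rw [h.rowLen_swapArms hp, h.colLen_swapArms hp]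
  omega

/-! ### Diagrams in a box with a large Frobenius difference -/

/-- The Frobenius difference at `i` exceeds `r`. -/
def IsJump (k r : ℕ) (μ : YoungDiagram) (i : ℕ) : Prop :=
  max (μ.rowLen i) i + r ≤ if i = 0 then k else μ.colLen (i - 1)

/-- The condition that corresponds to `IsJump` under `swapArms`. -/
def IsCoJump (k r : ℕ) (μ : YoungDiagram) (i : ℕ) : Prop :=
  μ.colLen i ≤ if i = 0 then k else μ.rowLen (i - 1) + r

/-- The swap turns each side of one inequality into the corresponding side of the other. The maximum
in `IsJump` is harmless because row j has at least i > j cells. -/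
theorem Swappable.isCoJump_swapArms_iff (h : Swappable i r μ) {j : ℕ} (hj : j < i) :
    IsCoJump k r (OddEvenMex.swapArms i r μ) j ↔ IsJump k r μ j := by
  have h1 := h.le_rowLen j hj
  rw [IsCoJump, IsJump, h.colLen_swapArms hj, max_eq_left (by omega)]
  split_ifs with h0
  · rfl
  · have := h.le_colLen (j - 1) (by omega)
    rw [h.rowLen_swapArms (by omega), Nat.sub_add_cancel (by omega)]

/-- The jump at i makes the first i columns long; the absence of a jump at i - 1 bounds column i by
the preceding rows. -/
theorem swappable_of_isJump (hk : μ.colLen 0 ≤ k) (hi : IsJump k r μ i)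
    (hlt : ∀ j < i, ¬ IsJump k r μ j) : Swappable i r μ := by
  rcases i with _ | i
  · exact ⟨by simp, by simp, by simp, by simp⟩
  have h1 := hlt i (by omega)
  simp only [IsJump, Nat.add_sub_cancel, Nat.add_eq_zero_iff, one_ne_zero, and_false, if_false]
    at hi h1
  have h2 : i < μ.rowLen i := lt_rowLen_iff_lt_colLen.2 (by omega)
  have h3 : μ.colLen (i + 1) ≤ μ.rowLen i + r := by
    have a1 := μ.colLen_anti 0 (i + 1) (by omega)
    have a2 := μ.colLen_anti (i - 1) (i + 1) (by omega)
    split_ifs at h1 <;> omega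
  refine ⟨fun p hp => ?_, fun p hp => ?_, fun p hp => ?_, fun p hp => ?_⟩ <;>
    have h4 := μ.rowLen_anti p i (by omega) <;> have h5 := μ.colLen_anti p i (by omega) <;> omega

/-- The first `i` with `IsCoJump` lies inside the Durfee square. -/
theorem le_rowLen_of_forall_not_isCoJump (hlt : ∀ j < i, ¬ IsCoJump k r μ j) :
    ∀ p < i, i ≤ μ.rowLen p := by
  induction i with
  | zero => simp
  | succ i ih =>
    -- Column i is longer than row i - 1 (or than k if i = 0), and that row has at least i cells by
    -- induction, so the cell (i, i) is present.
    have hp : i < μ.colLen i := by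
      have h1 := hlt i (by omega)
      rw [IsCoJump] at h1
      rcases i with _ | i
      · simp only [if_true] at h1
        omega
      · have := ih (fun j hj => hlt j (by omega)) i (by omega)
        simp only [Nat.add_sub_cancel, Nat.add_eq_zero_iff, one_ne_zero, and_false, if_false] at h1
        omega
    intro p hp'
    have h2 := lt_rowLen_iff_lt_colLen.2 hp
    have := μ.rowLen_anti p i (by omega)
    omega

/-- The co-jump at i bounds column i; its absence at i - 1 makes the earlier columns long. For i = 1
the latter only says that column 0 exceeds k, whence the hypothesis on row 0. -/
theorem swappable_of_isCoJump (hk : μ.rowLen 0 + r ≤ k) (hi : IsCoJump k r μ i)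
    (hlt : ∀ j < i, ¬ IsCoJump k r μ j) : Swappable i r μ := by
  have h0 := le_rowLen_of_forall_not_isCoJump hlt
  rcases i with _ | i
  · exact ⟨by simp, by simp, by simp, by simp⟩
  have h1 := hlt i (by omega)
  simp only [IsCoJump, Nat.add_sub_cancel, Nat.add_eq_zero_iff, one_ne_zero, and_false, if_false]
    at hi h1
  have h2 := μ.rowLen_anti 0 (i + 1) (by omega)
  have h3 := μ.rowLen_anti (i - 1) (i + 1) (by omega)
  have h6 := h0 (i - 1) (by omega)
  have h7 := h0 0 (by omega)
  refine ⟨fun p hp => ?_, fun p hp => ?_, h0, fun p hp => ?_⟩ <;>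
    have h4 := μ.rowLen_anti p i (by omega) <;> have h5 := μ.colLen_anti p i (by omega) <;>
    split_ifs at h1 <;> omega

/-- Diagrams in a `k × l` box with a Frobenius difference exceeding `r`. -/
def jumpSet (k l r : ℕ) : Set YoungDiagram :=
  {μ | μ.colLen 0 ≤ k ∧ μ.rowLen 0 ≤ l ∧ ∃ i, IsJump k r μ i}

/-- Diagrams in a `(l + r) × (k - r)` box. -/
def shiftedBox (k l r : ℕ) : Set YoungDiagram :=
  {μ | μ.rowLen 0 + r ≤ k ∧ μ.colLen 0 ≤ l + r}

theorem exists_isCoJump (k r : ℕ) (μ : YoungDiagram) : ∃ i, IsCoJump k r μ i := by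
  refine ⟨μ.rowLen 0, ?_⟩
  rw [IsCoJump, colLen_eq_zero_of_le le_rfl]
  exact Nat.zero_le _

/-- For i > 0 the first row and column trade lengths with the shift by r, which is exactly the
change of box. For i = 0 nothing moves: the jump itself bounds the rows, and `k ≤ l` bounds the
columns. -/
theorem swapArms_mem_shiftedBox (hkl : k ≤ l) (hμ : μ ∈ jumpSet k l r) (hi : IsJump k r μ i)
    (hlt : ∀ j < i, ¬ IsJump k r μ j) :
    swapArms i r μ ∈ shiftedBox k l r ∧ IsCoJump k r (swapArms i r μ) i ∧
      ∀ j < i, ¬ IsCoJump k r (swapArms i r μ) j := by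
  have h := swappable_of_isJump hμ.1 hi hlt
  refine ⟨?_, ?_, fun j hj => by rw [h.isCoJump_swapArms_iff hj]; exact hlt j hj⟩
  · obtain ⟨h1, h2, -⟩ := hμ
    rcases i with _ | i
    · have h3 := (h.rowLen_swapArms_le (Nat.zero_le (k - r)))
      have h4 := (h.colLen_swapArms_le (Nat.zero_le k))
      simp only [IsJump, if_true, Nat.max_zero] at hi
      exact ⟨by omega, by omega⟩
    · have h3 := h.le_colLen 0 (by omega)
      have h4 := h.rowLen_swapArms (p := 0) (by omega)
      have h5 := h.colLen_swapArms (q := 0) (by omega)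
      exact ⟨by omega, by omega⟩
  · rw [IsCoJump]
    rcases i with _ | i
    · rw [if_pos rfl, h.colLen_swapArms_le (Nat.zero_le _)]
      exact hμ.1
    · have h3 := h.le_colLen i (by omega)
      have h4 := h.rowLen_swapArms (p := i) (by omega)
      have h5 := μ.colLen_anti i (i + 1) (by omega)
      rw [if_neg (by omega), Nat.add_sub_cancel, h.colLen_swapArms_le (by omega)]
      omega

theorem swapArms_mem_jumpSet (hkl : k ≤ l) (hμ : μ ∈ shiftedBox k l r) (hi : IsCoJump k r μ i)
    (hlt : ∀ j < i, ¬ IsCoJump k r μ j) :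
    swapArms i r μ ∈ jumpSet k l r ∧ IsJump k r (swapArms i r μ) i ∧
      ∀ j < i, ¬ IsJump k r (swapArms i r μ) j := by
  have h := swappable_of_isCoJump hμ.1 hi hlt
  have hjump : IsJump k r (swapArms i r μ) i := by
    rw [IsJump]
    rcases i with _ | i
    · have h3 := (h.rowLen_swapArms_le (Nat.zero_le (k - r)))
      obtain ⟨h1, -⟩ := hμ
      rw [if_pos rfl]
      omega
    · have h3 := h.le_rowLen i (by omega)
      have h4 := h.colLen_swapArms (q := i) (by omega)
      have h5 := μ.rowLen_anti i (i + 1) (by omega)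
      have h6 := h.rowLen_swapArms_le (n := μ.rowLen i) (by omega)
      rw [if_neg (by omega), Nat.add_sub_cancel]
      omega
  refine ⟨⟨?_, ?_, i, hjump⟩, hjump, fun j hj => ?_⟩
  · obtain ⟨h1, h2⟩ := hμ
    rcases i with _ | i
    · rw [h.colLen_swapArms_le (Nat.zero_le _)]
      simpa [IsCoJump] using hi
    · rwa [h.colLen_swapArms (by omega)]
  · obtain ⟨h1, h2⟩ := hμ
    rcases i with _ | i
    · rw [h.rowLen_swapArms_le (Nat.zero_le _)]
      omega
    · rw [h.rowLen_swapArms (by omega)]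
      omega
  · rw [← h.swapArms.isCoJump_swapArms_iff hj, h.swapArms_swapArms]
    exact hlt j hj

/-- Exchange arms and legs before the first large Frobenius difference. -/
noncomputable def reflectArms (k r : ℕ) (μ : YoungDiagram) : YoungDiagram :=
  swapArms (sInf {i | IsJump k r μ i}) r μ

theorem isJump_sInf (h : ∃ i, IsJump k r μ i) : IsJump k r μ (sInf {i | IsJump k r μ i}) :=
  Nat.sInf_mem (s := {i | IsJump k r μ i}) h

theorem isCoJump_sInf (h : ∃ i, IsCoJump k r μ i) : IsCoJump k r μ (sInf {i | IsCoJump k r μ i}) :=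
  Nat.sInf_mem (s := {i | IsCoJump k r μ i}) h

theorem eq_sInf_of_forall_not {P : ℕ → Prop} (hi : P i) (hlt : ∀ j < i, ¬ P j) :
    sInf {i | P i} = i := by
  refine le_antisymm (Nat.sInf_le hi) ?_
  by_contra! h
  exact hlt _ h (Nat.sInf_mem (s := {i | P i}) ⟨i, hi⟩)

theorem card_reflectArms (h : μ ∈ jumpSet k l r) : (reflectArms k r μ).card = μ.card :=
  (swappable_of_isJump h.1 (isJump_sInf h.2.2) fun _ => Nat.notMem_of_lt_sInf).card_swapArms

/-- The first jump of a diagram is the first co-jump of its image, so swapping again there is the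
inverse. A co-jump always exists, so no condition besides the box remains on the image. -/
theorem bijOn_reflectArms (hkl : k ≤ l) :
    Set.BijOn (reflectArms k r) (jumpSet k l r) (shiftedBox k l r) := by
  refine Set.InvOn.bijOn (f' := fun μ => swapArms (sInf {i | IsCoJump k r μ i}) r μ)
    ⟨fun μ hμ => ?_, fun μ hμ => ?_⟩ (fun μ hμ => ?_) fun μ hμ => ?_
  · have hi := isJump_sInf hμ.2.2
    obtain ⟨-, h1, h2⟩ := swapArms_mem_shiftedBox hkl hμ hi fun _ => Nat.notMem_of_lt_sInf
    simp only [reflectArms]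
    rw [eq_sInf_of_forall_not h1 h2]
    exact (swappable_of_isJump hμ.1 hi fun _ => Nat.notMem_of_lt_sInf).swapArms_swapArms
  · have hi := isCoJump_sInf (exists_isCoJump k r μ)
    obtain ⟨-, h1, h2⟩ := swapArms_mem_jumpSet hkl hμ hi fun _ => Nat.notMem_of_lt_sInf
    simp only [reflectArms]
    rw [eq_sInf_of_forall_not h1 h2]
    exact (swappable_of_isCoJump hμ.1 hi fun _ => Nat.notMem_of_lt_sInf).swapArms_swapArms
  · exact (swapArms_mem_shiftedBox hkl hμ (isJump_sInf hμ.2.2) fun _ => Nat.notMem_of_lt_sInf).1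
  · exact (swapArms_mem_jumpSet hkl hμ (isCoJump_sInf (exists_isCoJump k r μ))
      fun _ => Nat.notMem_of_lt_sInf).1

/-! ### The Frobenius maximum -/

theorem lt_diagLength_iff (μ : YoungDiagram) (i : ℕ) : i < diagLength μ ↔ i < μ.rowLen i := by
  have hex : ∃ d, ¬ d < μ.rowLen d :=
    ⟨μ.colLen 0, by rw [rowLen_eq_zero_of_le le_rfl]; exact Nat.not_lt_zero _⟩
  have hd : ∀ j, j < μ.rowLen j ↔ j < Nat.find hex := by
    intro j
    refine ⟨fun h => ?_, fun h => not_not.1 (Nat.find_min hex h)⟩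
    refine lt_of_not_ge fun hle => ?_
    exact Nat.find_spec hex (hle.trans_lt (h.trans_le (μ.rowLen_anti _ _ hle)))
  have himage : (μ.cells.filter fun c => c.1 = c.2) =
      (Finset.range (Nat.find hex)).image fun j => (j, j) := by
    ext ⟨p, q⟩
    simp only [Finset.mem_filter, mem_cells, Finset.mem_image, Finset.mem_range, Prod.mk.injEq]
    constructor
    · rintro ⟨h, rfl⟩
      exact ⟨p, (hd p).1 (mem_iff_lt_rowLen.1 h), rfl, rfl⟩
    · rintro ⟨j, h, rfl, rfl⟩
      exact ⟨mem_iff_lt_rowLen.2 ((hd j).2 h), rfl⟩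
  rw [hd, diagLength, himage, Finset.card_image_of_injective _ fun a b h => (Prod.mk.inj h).1,
    Finset.card_range]

/-- With rows and columns counted from 0, y_i - x_{i+1} - 1 is column i - 1 minus row i. The maximum
with i in `IsJump` accounts for x_{d+1} = -1, since row d has at most d cells. A jump at i > 0
forces the diagonal cell (i - 1, i - 1), so no index beyond d contributes. -/
theorem le_frobeniusMax_iff : (r : ℤ) ≤ frobeniusMax k μ ↔ ∃ i, IsJump k r μ i := by
  rw [frobeniusMax, le_sub_iff_add_le, Finset.le_sup'_iff]
  have key : ∀ i ≤ diagLength μ,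
      ((r : ℤ) + 1 ≤ frobY k μ i - frobX μ (i + 1) ↔ IsJump k r μ i) := by
    intro i hi
    have h1 := lt_diagLength_iff μ i
    have h2 : i = diagLength μ → μ.rowLen i ≤ i := fun h => by omega
    rw [frobY, frobX, IsJump, Nat.add_sub_cancel]
    split_ifs <;> push_cast <;> omega
  constructor
  · rintro ⟨i, hi, h⟩
    exact ⟨i, (key i (by simpa [Nat.lt_succ_iff] using hi)).1 h⟩
  · rintro ⟨i, h⟩
    have hi : i ≤ diagLength μ := by
      rcases i with _ | i
      · exact Nat.zero_le _
      · rw [Nat.succ_le_iff, lt_diagLength_iff, lt_rowLen_iff_lt_colLen]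
        simp only [IsJump, Nat.add_sub_cancel, Nat.add_eq_zero_iff, one_ne_zero, and_false,
          if_false] at h
        omega
    exact ⟨i, by simpa [Nat.lt_succ_iff] using hi, (key i hi).2 h⟩


end Arms

/-! ### The Durfee rectangle -/

theorem range_product_subset_cells_iff {k l : ℕ} {μ : YoungDiagram} :
    Finset.range k ×ˢ Finset.range l ⊆ μ.cells ↔ ∀ p < k, l ≤ μ.rowLen p := by
  constructor
  · intro h p hp
    by_contra! hlt
    have : (p, μ.rowLen p) ∈ μ := (mem_cells _).1 (h (by simp [hp, hlt]))
    rw [mem_iff_lt_rowLen] at this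
    omega
  · rintro h ⟨p, q⟩ hc
    simp only [Finset.mem_product, Finset.mem_range] at hc
    exact (mem_cells _).2 (mem_iff_lt_rowLen.2 (hc.2.trans_le (h p hc.1)))

theorem durfeeSide_eq {a k : ℕ} {μ : YoungDiagram} (h : ∀ p < k, k + a ≤ μ.rowLen p)
    (hk : μ.rowLen k ≤ k + a) : durfeeSide a μ = k := by
  refine IsGreatest.csSup_eq ⟨range_product_subset_cells_iff.2 h, fun k' hk' => ?_⟩
  by_contra! hlt
  have := range_product_subset_cells_iff.1 hk' k hlt
  omega

theorem durfeeSide_spec (a : ℕ) (μ : YoungDiagram) :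
    (∀ p < durfeeSide a μ, durfeeSide a μ + a ≤ μ.rowLen p) ∧
      μ.rowLen (durfeeSide a μ) ≤ durfeeSide a μ + a := by
  have hbdd : BddAbove {k : ℕ | Finset.range k ×ˢ Finset.range (k + a) ⊆ μ.cells} := by
    refine ⟨μ.rowLen 0, fun k hk => ?_⟩
    rcases Nat.eq_zero_or_pos k with rfl | h0
    · exact Nat.zero_le _
    · have := range_product_subset_cells_iff.1 hk 0 h0
      omega
  refine ⟨range_product_subset_cells_iff.1 (Nat.sSup_mem ⟨0, by simp⟩ hbdd), ?_⟩
  by_contra! hlt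
  have : durfeeSide a μ + 1 ≤ durfeeSide a μ :=
    le_csSup hbdd (range_product_subset_cells_iff.2 fun p hp => by
      have := μ.rowLen_anti p (durfeeSide a μ) (by omega)
      omega)
  omega

theorem mem_rightPart {k l i j : ℕ} {μ : YoungDiagram} :
    (i, j) ∈ rightPart k l μ ↔ i < k ∧ (i, j + l) ∈ μ :=
  Finset.mem_filter.trans
    ⟨fun h => h.2, fun h => ⟨(mem_cells _).2 (μ.up_left_mem le_rfl (by omega) h.2), h⟩⟩

theorem rowLen_rightPart (k l : ℕ) (μ : YoungDiagram) (i : ℕ) :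
    (rightPart k l μ).rowLen i = if i < k then μ.rowLen i - l else 0 := by
  refine rowLen_eq_of_forall fun j => ?_
  rw [mem_rightPart, mem_iff_lt_rowLen]
  split_ifs <;> omega

theorem colLen_rightPart_le (k l : ℕ) (μ : YoungDiagram) : (rightPart k l μ).colLen 0 ≤ k := by
  rw [← rowLen_le_iff_colLen_le, rowLen_rightPart, if_neg (lt_irrefl k)]

/-- The data `(k, R, C)` belonging to a diagram: the side `k` of its Durfee rectangle, the residual
diagram `R` of the part to the right of the rectangle, and the multiset `C` of the lengths of the
rows below the rectangle and of the rim hooks. -/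
noncomputable def durfeeCode (a : ℕ) (μ : YoungDiagram) : ℕ × YoungDiagram × Multiset ℕ :=
  let k := durfeeSide a μ
  (k, residual (k + a) (rightPart k (k + a) μ),
    partsOf (lowerPart k μ) + (heights (k + a) (rightPart k (k + a) μ)).map (· + (k + a)))

/-- The triples that occur as `durfeeCode a μ`. -/
def codeSet (a : ℕ) : Set (ℕ × YoungDiagram × Multiset ℕ) :=
  {c | c.2.1.colLen 0 ≤ c.1 ∧ c.2.1.rowLen 0 ≤ c.1 + a ∧ ∀ x ∈ c.2.2, 0 < x ∧ x ≤ 2 * c.1 + a}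

/-- The number of cells of a diagram in terms of its code. -/
def codeWeight (a : ℕ) (c : ℕ × YoungDiagram × Multiset ℕ) : ℕ :=
  c.1 * (c.1 + a) + c.2.1.card + c.2.2.sum

theorem codeWeight_durfeeCode (a : ℕ) (μ : YoungDiagram) :
    codeWeight a (durfeeCode a μ) = μ.card := by
  obtain ⟨h1, -⟩ := durfeeSide_spec a μ
  simp only [codeWeight, durfeeCode, Multiset.sum_add, sum_partsOf]
  generalize durfeeSide a μ = k at *
  have h2 := card_eq_card_residual_add (k + a) (rightPart k (k + a) μ)
  rw [card_eq_sum_rowLen (colLen_rightPart_le _ _ _)] at h2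
  have h3 : ∑ i ∈ Finset.range k, μ.rowLen i =
      ∑ i ∈ Finset.range k, (rightPart k (k + a) μ).rowLen i + k * (k + a) := by
    have h4 : ∑ i ∈ Finset.range k, (k + a) = k * (k + a) := by simp
    rw [← h4, ← Finset.sum_add_distrib]
    refine Finset.sum_congr rfl fun i hi => ?_
    have hi := Finset.mem_range.1 hi
    have := h1 i hi
    rw [rowLen_rightPart, if_pos hi]
    omega
  rw [card_eq_sum_add_card_lowerPart k μ, h3, h2]
  omega

theorem durfeeCode_mem_codeSet (a : ℕ) (μ : YoungDiagram) : durfeeCode a μ ∈ codeSet a := by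
  refine ⟨?_, rowLen_residual_le _ _, fun x hx => ?_⟩
  · exact (colLen_residual_le _ _ _).trans (colLen_rightPart_le _ _ _)
  · simp only [durfeeCode, Multiset.mem_add, Multiset.mem_map] at hx ⊢
    rcases hx with hx | ⟨h, hh, rfl⟩
    · have := le_of_mem_partsOf (l := durfeeSide a μ + a)
        (by rw [rowLen_lowerPart, zero_add]; exact (durfeeSide_spec a μ).2) hx
      exact ⟨(mem_partsOf.1 hx).1, by omega⟩
    · have h1 := pos_of_mem_heights hh
      have h2 := heights_le (colLen_rightPart_le _ _ _) hh
      omega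

/-- This separates the third component of a code: rows below the rectangle have length at most l = k
+ a, hooks exceed it. -/
theorem filter_add_map_add {l : ℕ} {s t : Multiset ℕ} (hs : ∀ x ∈ s, x ≤ l)
    (ht : ∀ x ∈ t, 0 < x) :
    (s + t.map (· + l)).filter (· ≤ l) = s ∧
      ((s + t.map (· + l)).filter (¬ · ≤ l)).map (· - l) = t := by
  have h1 : (t.map (· + l)).filter (· ≤ l) = 0 := by
    simp only [Multiset.filter_eq_nil, Multiset.mem_map]
    rintro _ ⟨x, hx, rfl⟩
    have := ht x hx
    omega
  have h2 : (t.map (· + l)).filter (¬ · ≤ l) = t.map (· + l) := by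
    simp only [Multiset.filter_eq_self, Multiset.mem_map]
    rintro _ ⟨x, hx, rfl⟩
    have := ht x hx
    omega
  have h3 : s.filter (¬ · ≤ l) = 0 := by
    simp only [Multiset.filter_eq_nil, not_not]
    exact hs
  rw [Multiset.filter_add, Multiset.filter_add, h1, h2, h3, Multiset.filter_eq_self.2 hs,
    Multiset.map_add, Multiset.map_map]
  simp

theorem durfeeCode_injective (a : ℕ) : Function.Injective (durfeeCode a) := by
  intro μ ν h
  have key : ∀ μ : YoungDiagram, ∀ k, durfeeSide a μ = k →
      (durfeeCode a μ).2.2.filter (· ≤ k + a) = partsOf (lowerPart k μ) ∧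
      ((durfeeCode a μ).2.2.filter (¬ · ≤ k + a)).map (· - (k + a)) =
        heights (k + a) (rightPart k (k + a) μ) := by
    rintro μ k rfl
    exact filter_add_map_add (fun x hx => le_of_mem_partsOf
      (by rw [rowLen_lowerPart, zero_add]; exact (durfeeSide_spec a μ).2) hx)
      fun x hx => pos_of_mem_heights hx
  obtain ⟨k, hk⟩ : ∃ k, durfeeSide a μ = k := ⟨_, rfl⟩
  have hk' : durfeeSide a ν = k := (congrArg Prod.fst h).symm.trans hk
  obtain ⟨h1, h2⟩ := key μ k hk
  obtain ⟨h3, h4⟩ := key ν k hk'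
  have hr : (durfeeCode a μ).2.1 = (durfeeCode a ν).2.1 := by rw [h]
  simp only [durfeeCode, hk, hk'] at hr
  rw [h, h3] at h1
  rw [h, h4] at h2
  have hlow := partsOf_injective h1
  have hright := eq_of_residual_eq_of_heights_eq hr h2.symm
  refine ext_rowLen fun i => ?_
  rcases lt_or_ge i k with hi | hi
  · have e := congrArg (fun ρ => ρ.rowLen i) hright
    simp only [rowLen_rightPart, if_pos hi] at e
    have e1 := (durfeeSide_spec a μ).1 i (by omega)
    have e2 := (durfeeSide_spec a ν).1 i (by omega)
    omega
  · have e := congrArg (fun ρ => ρ.rowLen (i - k)) hlow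
    simp only [rowLen_lowerPart, Nat.sub_add_cancel hi] at e
    exact e.symm

theorem exists_durfee {a k : ℕ} {α β : YoungDiagram} (hα : α.colLen 0 ≤ k)
    (hβ : β.rowLen 0 ≤ k + a) :
    ∃ μ, durfeeSide a μ = k ∧ rightPart k (k + a) μ = α ∧ lowerPart k μ = β := by
  obtain ⟨μ, hμ⟩ := exists_rowLen_eq (N := k + β.colLen 0)
    (fun i => if i < k then k + a + α.rowLen i else β.rowLen (i - k)) (by
      intro i j hij
      have h1 := α.rowLen_anti i j hij
      have h2 := β.rowLen_anti (i - k) (j - k) (by omega)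
      have h3 := β.rowLen_anti 0 (j - k) (by omega)
      simp only
      split_ifs <;> omega) (by
      rw [if_neg (by omega), Nat.add_sub_cancel_left, rowLen_eq_zero_of_le le_rfl])
  refine ⟨μ, durfeeSide_eq (fun p hp => ?_) ?_, ext_rowLen fun i => ?_, ext_rowLen fun i => ?_⟩
  · rw [hμ, if_pos hp]
    omega
  · rwa [hμ, if_neg (lt_irrefl k), Nat.sub_self]
  · rw [rowLen_rightPart, hμ]
    split_ifs with hi
    · omega
    · rw [rowLen_eq_zero_of_le (by omega)]
  · rw [rowLen_lowerPart, hμ, if_neg (by omega), Nat.add_sub_cancel]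

theorem bijOn_durfeeCode (a : ℕ) : Set.BijOn (durfeeCode a) Set.univ (codeSet a) := by
  refine ⟨fun μ _ => durfeeCode_mem_codeSet a μ, (durfeeCode_injective a).injOn, ?_⟩
  rintro ⟨k, ρ, s⟩ ⟨h1, h2, h3⟩
  simp only at h1 h2 h3
  obtain ⟨α, hα, hr, hh⟩ := exists_residual_eq_heights_eq h1 h2
    (s := (s.filter (¬ · ≤ k + a)).map (· - (k + a))) (by
      intro x hx
      obtain ⟨y, hy, rfl⟩ := Multiset.mem_map.1 hx
      obtain ⟨hy, hlt⟩ := Multiset.mem_filter.1 hy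
      have := h3 y hy
      omega)
  obtain ⟨β, hβ⟩ := exists_partsOf_eq (s := s.filter (· ≤ k + a))
    fun x hx => (h3 x (Multiset.mem_filter.1 hx).1).1
  obtain ⟨μ, e1, e2, e3⟩ := exists_durfee hα (rowLen_zero_le_of_partsOf (μ := β) (l := k + a)
    fun x hx => by
      rw [hβ] at hx
      exact (Multiset.mem_filter.1 hx).2)
  refine ⟨μ, Set.mem_univ _, ?_⟩
  simp only [durfeeCode, e1, e2, e3, hr, hh, hβ, Multiset.map_map]
  rw [Multiset.map_congr (g := id) rfl fun x hx => ?_, Multiset.map_id, Multiset.filter_add_not]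
  have := (Multiset.mem_filter.1 hx).2
  simp only [Function.comp_apply, id]
  omega

/-! ### Diagrams with large rank -/

/-- Reflection of codes. -/
noncomputable def reflectCode (r : ℕ) (c : ℕ × YoungDiagram × Multiset ℕ) :
    ℕ × YoungDiagram × Multiset ℕ :=
  (c.1 - r, (reflectArms c.1 r c.2.1).transpose, c.2.2)

/-- With k = j + r, the bound 2k + a equals 2j + (a + 2r), so the multiset is kept, and k(k + a) =
j(j + a + 2r) + r(r + a) accounts for the change of weight. -/
theorem bijOn_reflectCode (a r n : ℕ) :
    Set.BijOn (reflectCode r)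
      {c ∈ codeSet a | codeWeight a c = n ∧ ∃ i, IsJump c.1 r c.2.1 i}
      {c ∈ codeSet (a + 2 * r) | codeWeight (a + 2 * r) c + r * (r + a) = n} := by
  have hbij : ∀ k, Set.BijOn (reflectArms k r) (jumpSet k (k + a) r) (shiftedBox k (k + a) r) :=
    fun k => bijOn_reflectArms (Nat.le_add_right k a)
  refine ⟨?_, ?_, ?_⟩
  · rintro ⟨k, μ, s⟩ ⟨⟨h1, h2, h3⟩, h4, h5⟩
    simp only [codeWeight] at h1 h2 h3 h4 h5
    have hμ : μ ∈ jumpSet k (k + a) r := ⟨h1, h2, h5⟩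
    obtain ⟨h6, h7⟩ := (hbij k).mapsTo hμ
    obtain ⟨j, rfl⟩ : ∃ j, k = j + r := ⟨k - r, by omega⟩
    refine ⟨⟨?_, ?_, fun x hx => ?_⟩, ?_⟩
    · simp only [reflectCode, colLen_transpose]
      omega
    · simp only [reflectCode, rowLen_transpose]
      omega
    · have := h3 x hx
      simp only [reflectCode]
      omega
    · simp only [codeWeight, reflectCode, card_transpose, card_reflectArms hμ, ← h4,
        Nat.add_sub_cancel]
      ring
  · rintro ⟨k, μ, s⟩ ⟨⟨h1, h2, -⟩, -, h5⟩ ⟨k', μ', s'⟩ ⟨⟨h1', h2', -⟩, -, h5'⟩ h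
    simp only [reflectCode, Prod.mk.injEq, transpose_eq_iff] at h1 h2 h5 h1' h2' h5' h
    have hμ : μ ∈ jumpSet k (k + a) r := ⟨h1, h2, h5⟩
    have hμ' : μ' ∈ jumpSet k' (k' + a) r := ⟨h1', h2', h5'⟩
    have h6 := ((hbij k).mapsTo hμ).1
    have h6' := ((hbij k').mapsTo hμ').1
    obtain ⟨e1, e2, e3⟩ := h
    obtain rfl : k = k' := by omega
    rw [(hbij k).injOn hμ hμ' e2, e3]
  · rintro ⟨j, ν, s⟩ ⟨⟨h1, h2, h3⟩, h4⟩
    simp only [codeWeight] at h1 h2 h3 h4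
    obtain ⟨μ, hμ, hμν⟩ := (hbij (j + r)).surjOn
      (show ν.transpose ∈ shiftedBox (j + r) (j + r + a) r from
        ⟨by rw [rowLen_transpose]; omega, by rw [colLen_transpose]; omega⟩)
    refine ⟨(j + r, μ, s), ⟨⟨hμ.1, hμ.2.1, fun x hx => ?_⟩, ?_, hμ.2.2⟩, ?_⟩
    · have := h3 x hx
      simp only
      omega
    · have := card_reflectArms hμ
      rw [hμν, card_transpose] at this
      simp only [codeWeight, ← h4, ← this]
      ring
    · simp [reflectCode, hμν]

theorem bijOn_sep {α β : Type*} {f : α → β} {t : Set β} (hf : Set.BijOn f Set.univ t)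
    (p : β → Prop) : Set.BijOn f {x | p (f x)} {y ∈ t | p y} := by
  refine ⟨fun x hx => ⟨hf.mapsTo (Set.mem_univ x), hx⟩, hf.injOn.mono (Set.subset_univ _), ?_⟩
  rintro y ⟨hy, hp⟩
  obtain ⟨x, -, rfl⟩ := hf.surjOn hy
  exact ⟨x, hp, rfl⟩

/-- The coding is used twice, with a and with a + 2r; the second use is why arbitrary a is needed
although only a = 0, 1 matter in the end. -/
theorem ncard_le_durfeeRank (a r n : ℕ) :
    {μ : YoungDiagram | μ.card = n ∧ (r : ℤ) ≤ durfeeRank a μ}.ncard =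
      {μ : YoungDiagram | μ.card + r * (r + a) = n}.ncard := by
  have h1 := bijOn_sep (bijOn_durfeeCode a) fun c => codeWeight a c = n ∧ ∃ i, IsJump c.1 r c.2.1 i
  have h2 := bijOn_sep (bijOn_durfeeCode (a + 2 * r))
    fun c => codeWeight (a + 2 * r) c + r * (r + a) = n
  have h3 := h1.ncard_eq.trans ((bijOn_reflectCode a r n).ncard_eq.trans h2.ncard_eq.symm)
  simp only [codeWeight_durfeeCode, ← le_frobeniusMax_iff] at h3
  exact h3

theorem ncard_partition_le_durfeeRank (a r n : ℕ) :
    {p : n.Partition | (r : ℤ) ≤ durfeeRank a (ferrers p)}.ncard =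
      {μ : YoungDiagram | μ.card + r * (r + a) = n}.ncard := by
  rw [← ncard_le_durfeeRank]
  exact (bijOn_sep (ferrers_bijOn n) fun μ => (r : ℤ) ≤ durfeeRank a μ).ncard_eq

/-! ### Partitions with large minimal excludant -/

/-- The multiset of the `r` smallest positive integers congruent to `1 + a` modulo `2` that are
larger than `a`. -/
def staircase (a r : ℕ) : Multiset ℕ := (Multiset.range r).map fun j => 2 * j + 1 + a

theorem sum_staircase (a r : ℕ) : (staircase a r).sum = r * (r + a) := by
  induction r with
  | zero => simp [staircase]
  | succ r ih =>
    rw [staircase, Multiset.range_succ, Multiset.map_cons, Multiset.sum_cons, ← staircase, ih]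
    ring

theorem staircase_le_iff {a r : ℕ} {s : Multiset ℕ} :
    staircase a r ≤ s ↔ ∀ j < r, 2 * j + 1 + a ∈ s := by
  rw [Multiset.le_iff_subset]
  · simp [Multiset.subset_iff, staircase]
  · exact (Multiset.nodup_range r).map fun i j h => by omega

theorem bijOn_parts (n : ℕ) : Set.BijOn (fun p : n.Partition => p.parts) Set.univ
    {s : Multiset ℕ | (∀ x ∈ s, 0 < x) ∧ s.sum = n} :=
  ⟨fun p _ => ⟨fun _ hx => p.parts_pos hx, p.parts_sum⟩, fun _ _ _ _ h => Nat.Partition.ext h,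
    fun s hs => ⟨⟨s, fun hx => hs.1 _ hx, hs.2⟩, Set.mem_univ _, rfl⟩⟩

theorem bijOn_partsOf : Set.BijOn partsOf Set.univ {s : Multiset ℕ | ∀ x ∈ s, 0 < x} :=
  ⟨fun _ _ _ hx => (mem_partsOf.1 hx).1, partsOf_injective.injOn, fun _ hs =>
    (exists_partsOf_eq hs).imp fun _ h => ⟨Set.mem_univ _, h⟩⟩

theorem ncard_partition_staircase (a r n : ℕ) :
    {p : n.Partition | ∀ j < r, 2 * j + 1 + a ∈ p.parts}.ncard =
      {μ : YoungDiagram | μ.card + r * (r + a) = n}.ncard := by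
  have h1 := bijOn_sep (bijOn_parts n) fun s => ∀ j < r, 2 * j + 1 + a ∈ s
  have h2 := bijOn_sep bijOn_partsOf fun s => s.sum + r * (r + a) = n
  simp only [sum_partsOf] at h2
  rw [h1.ncard_eq, h2.ncard_eq]
  symm
  refine Set.BijOn.ncard_eq (f := fun s => s + staircase a r) ⟨?_, ?_, ?_⟩
  · rintro s ⟨hs, hsum⟩
    refine ⟨⟨fun x hx => ?_, by rw [Multiset.sum_add, sum_staircase, hsum]⟩,
      staircase_le_iff.1 (Multiset.le_add_left _ _)⟩
    rcases Multiset.mem_add.1 hx with hx | hx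
    · exact hs x hx
    · obtain ⟨j, -, rfl⟩ := Multiset.mem_map.1 hx
      omega
  · exact fun s _ t _ h => add_right_cancel h
  · rintro s ⟨⟨hs, hsum⟩, hst⟩
    have hle := staircase_le_iff.2 hst
    refine ⟨s - staircase a r, ⟨fun x hx => hs x (Multiset.mem_of_le (Multiset.sub_le_self _ _) hx),
      ?_⟩, tsub_add_cancel_of_le hle⟩
    rw [← sum_staircase, ← Multiset.sum_add, tsub_add_cancel_of_le hle, hsum]

/-- The numbers over which `mex 2 (1 + a)` minimizes. -/
theorem mem_mexSet_iff {a k n : ℕ} (ha : a < 2) {p : n.Partition} :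
    (0 < k ∧ k ≡ 1 + a [MOD 2] ∧ k ∉ p.parts) ↔ (∃ j, k = 2 * j + 1 + a) ∧ k ∉ p.parts := by
  rw [← and_assoc, Nat.ModEq]
  refine and_congr_left fun _ => ⟨fun h => ⟨(k - 1 - a) / 2, ?_⟩, ?_⟩
  · omega
  · rintro ⟨j, rfl⟩
    omega

theorem le_mex_iff {a r n : ℕ} (ha : a < 2) {p : n.Partition} :
    2 * r + 1 + a ≤ mex 2 (1 + a) p ↔ ∀ j < r, 2 * j + 1 + a ∈ p.parts := by
  simp only [mex, mem_mexSet_iff ha]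
  have hne : {k | (∃ j, k = 2 * j + 1 + a) ∧ k ∉ p.parts}.Nonempty := by
    -- 2n + 1 + a exceeds n and cannot be a part. Nonemptiness matters because `sInf ∅ = 0`.
    refine ⟨_, ⟨n, rfl⟩, fun hmem => ?_⟩
    have := Multiset.le_sum_of_mem hmem
    rw [p.parts_sum] at this
    omega
  constructor
  · intro h j hj
    by_contra hmem
    have := h.trans (Nat.sInf_le (s := {k | (∃ j, k = 2 * j + 1 + a) ∧ k ∉ p.parts})
      ⟨⟨j, rfl⟩, hmem⟩)
    omega
  · rintro h
    obtain ⟨⟨j, hj⟩, hmem⟩ := Nat.sInf_mem hne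
    rw [hj] at hmem ⊢
    have := (mt (h j)) hmem
    omega

theorem mex_eq_iff {a r n : ℕ} (ha : a < 2) {p : n.Partition} :
    mex 2 (1 + a) p = 2 * r + 1 + a ↔
      (∀ j < r, 2 * j + 1 + a ∈ p.parts) ∧ ¬ ∀ j < r + 1, 2 * j + 1 + a ∈ p.parts := by
  constructor
  · intro h
    rw [← le_mex_iff ha, ← le_mex_iff ha, h]
    omega
  · rintro ⟨h1, h2⟩
    refine le_antisymm (Nat.sInf_le ((mem_mexSet_iff ha).2 ⟨⟨r, rfl⟩, fun h3 => h2 fun j hj => ?_⟩))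
      ((le_mex_iff ha).2 h1)
    rcases Nat.lt_succ_iff_lt_or_eq.1 hj with hj | rfl
    · exact h1 j hj
    · exact h3

theorem card_mex_eq_card_durfeeRank {a : ℕ} (ha : a < 2) (n r : ℕ) :
    Nat.card {p : n.Partition // mex 2 (1 + a) p = 2 * r + 1 + a} =
      Nat.card {p : n.Partition // durfeeRank a (ferrers p) = r} := by
  -- A level set is the difference of two nested tails, so equality of all tail counts suffices.
  have hdiff : ∀ P : ℕ → n.Partition → Prop, (∀ p, P (r + 1) p → P r p) →
      {p | P r p ∧ ¬ P (r + 1) p}.ncard = {p | P r p}.ncard - {p | P (r + 1) p}.ncard :=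
    fun P hP => Set.ncard_sdiff (s := {p | P (r + 1) p}) (t := {p | P r p}) hP
  have h1 := hdiff (fun r p => ∀ j < r, 2 * j + 1 + a ∈ p.parts) fun p h j hj => h j (by omega)
  have h2 := hdiff (fun r p => (r : ℤ) ≤ durfeeRank a (ferrers p)) fun p h => by
    push_cast at h
    omega
  rw [ncard_partition_staircase, ncard_partition_staircase, ← ncard_partition_le_durfeeRank,
    ← ncard_partition_le_durfeeRank, ← h2] at h1
  simp only [← mex_eq_iff ha] at h1
  refine h1.trans (congrArg Set.ncard (Set.ext fun p => ?_))
  change (r : ℤ) ≤ durfeeRank a (ferrers p) ∧ ¬ ((r + 1 : ℕ) : ℤ) ≤ durfeeRank a (ferrers p) ↔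
    durfeeRank a (ferrers p) = r
  omega

end OddEvenMex

theorem theorem1 (n r : ℕ) :
    Nat.card {p : n.Partition // OddEvenMex.mex 2 1 p = 2 * r + 1} =
        Nat.card {p : n.Partition // OddEvenMex.sqrank p = (r : ℤ)} ∧
      Nat.card {p : n.Partition // OddEvenMex.mex 2 2 p = 2 * r + 2} =
        Nat.card {p : n.Partition // OddEvenMex.rerank p = (r : ℤ)} :=
  ⟨OddEvenMex.card_mex_eq_card_durfeeRank (a := 0) (by omega) n r,
    OddEvenMex.card_mex_eq_card_durfeeRank (a := 1) (by omega) n r⟩
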